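/- For a subset $K\subset\mathbb R^3$ and a unit vector $\vec v$, let the crookedness $b_{\vec v}(K)$ be the number of connected components of the set of points of $K$ at which the orthogonal projection $K\to\mathbb R\vec v$ has a local maximum, and let the superbridge number be $s(K)=\max_{|\vec v|=1}b_{\vec v}(K)$. Let $\eta=\{(x,y,x^2)\mid x^2+y^2=1\}$ and $$N=\{\vec v=(v_1,v_2,v_3)\in S^2\mid v_3>0,\ b_{\vec v}(\eta)=2\}.$$ Let $n\ge1$ be an integer and let $\lambda_1,\lambda_2\colon\mathbb R\to\mathbb R$ be smooth $2\pi$-periodic functions such that * $\lambda_1(t)^2+\lambda_2(t)^2<1$ for all $t$; * $\lambda_1(t)=\lambda_2(t)=0$ if $|t|\le 3\pi/4n$; * $\lambda_1$ and $\lambda_2$ are locally constant and negative on the set of $t$ with $5\pi/4n\le|t|\le\pi$ and $\cos nt\ge-1/\sqrt2$. For $0\le\varepsilon\le1$ let $K^\varepsilon$ be the closed curve $$K^\varepsilon(t)=\bigl((1+\varepsilon\lambda_1(t))\cos nt,\ (1+\varepsilon\lambda_1(t))\sin nt,\ \varepsilon\lambda_2(t)+\cos^2nt\bigr),$$ and assume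 that $K=K^1$ is a knot, i.e. that $K^1$ is injective on $[0,2\pi)$. Put $$N^\varepsilon=\{\vec v\in S^2\mid v_3>0,\ b_{\vec v}(K^\varepsilon)=2n\}.$$ Then there exist $\varepsilon_0\in(0,1]$ and $\delta_0>0$ such that the following hold for every $\varepsilon\in(0,\varepsilon_0]$: (a) $s(K^\varepsilon)=2n$; (b) $N^\varepsilon\cap\{(x,y,z)\mid x<0\}\subset N\cap\{(x,y,z)\mid x<0\}$; (c) $b_{\vec v}(K^\varepsilon)=n$ for every unit vector $\vec v=(v_1,v_2,v_3)$ with $|v_3|<\delta_0$. -/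

import Mathlib

open scoped ContDiff

noncomputable section

namespace Superbridge

/-- Euclidean three-space; the coordinates `x, y, z` are those of index `0, 1, 2`. -/
abbrev E3 : Type := EuclideanSpace ℝ (Fin 3)

/-- The points of `K` at which the orthogonal projection `K → ℝ v` has a local maximum. -/
def localMaxPoints (K : Set E3) (v : E3) : Set E3 :=
  {p | p ∈ K ∧ IsLocalMaxOn (fun q : E3 => inner ℝ v q) K p}

/-- The crookedness `b_v(K)`: the number of connected components of the set of points of `K`
at which the orthogonal projection `K → ℝ v` has a local maximum. -/
def crookedness (v : E3) (K : Set E3) : ℕ∞ :=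
  ENat.card (ConnectedComponents (localMaxPoints K v))

/-- The superbridge number `s(K)`: the maximum of `b_v(K)` over all unit vectors `v`.
(A supremum in `ℕ∞` that is finite is attained.) -/
def superbridgeNumber (K : Set E3) : ℕ∞ :=
  ⨆ v : Metric.sphere (0 : E3) 1, crookedness (v : E3) K

/-- The unknot `η`: the image of the circle `x² + y² = 1` under `(x, y) ↦ (x, y, x²)`. -/
def eta : Set E3 :=
  {p | ∃ x y : ℝ, x ^ 2 + y ^ 2 = 1 ∧ p = !₂[x, y, x ^ 2]}

/-- The unit vectors `v` with `v₃ > 0` and `b_v(K) = m`. -/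
def upperDirections (K : Set E3) (m : ℕ∞) : Set E3 :=
  {v | v ∈ Metric.sphere (0 : E3) 1 ∧ 0 < v 2 ∧ crookedness v K = m}

/-- The set `N` of unit vectors `v` with `v₃ > 0` and `b_v(η) = 2`. -/
def dirN : Set E3 := upperDirections eta 2

/-- The parametrization
`t ↦ ((1 + ε l₁(t)) cos nt, (1 + ε l₁(t)) sin nt, ε l₂(t) + cos² nt)`. -/
def braidCurve (n : ℕ) (l₁ l₂ : ℝ → ℝ) (ε : ℝ) (t : ℝ) : E3 :=
  !₂[(1 + ε * l₁ t) * Real.cos (n * t),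
     (1 + ε * l₁ t) * Real.sin (n * t),
     ε * l₂ t + Real.cos (n * t) ^ 2]

/-- The curve `K^ε` as a subset of space. -/
def braidKnot (n : ℕ) (l₁ l₂ : ℝ → ℝ) (ε : ℝ) : Set E3 :=
  Set.range (braidCurve n l₁ l₂ ε)

/-- The set of `t` with `5π/(4n) ≤ |t| ≤ π` and `cos nt ≥ -1/√2`. -/
def parallelRegion (n : ℕ) : Set ℝ :=
  {t | 5 * Real.pi / (4 * n) ≤ |t| ∧ |t| ≤ Real.pi ∧ -(1 / Real.sqrt 2) ≤ Real.cos (n * t)}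

/-- The conditions on the functions `l₁`, `l₂` under which `K = K^1` is a closed `n`-braid
in the standard position near `η`. -/
structure IsBraidData (n : ℕ) (l₁ l₂ : ℝ → ℝ) : Prop where
  pos : 0 < n
  smooth₁ : ContDiff ℝ ∞ l₁
  smooth₂ : ContDiff ℝ ∞ l₂
  periodic₁ : Function.Periodic l₁ (2 * Real.pi)
  periodic₂ : Function.Periodic l₂ (2 * Real.pi)
  /-- `K` is a knot: the closed curve `K^1` is simple. -/
  simple : Set.InjOn (braidCurve n l₁ l₂ 1) (Set.Ico 0 (2 * Real.pi))
  in_torus : ∀ t, l₁ t ^ 2 + l₂ t ^ 2 < 1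
  as_eta : ∀ t, |t| ≤ 3 * Real.pi / (4 * n) → l₁ t = 0 ∧ l₂ t = 0
  locallyConstant₁ : IsLocallyConstant ((parallelRegion n).domRestrict l₁)
  locallyConstant₂ : IsLocallyConstant ((parallelRegion n).domRestrict l₂)
  neg : ∀ t ∈ parallelRegion n, l₁ t < 0 ∧ l₂ t < 0

end Superbridge

end

/-! With the angle `s = nt` as parameter, `K^ε` runs `n` times around `η`, and its height in
direction `v` has derivative `etaDeriv v 0 + ε * E`, with `E` and its first derivatives bounded
uniformly in `v`. Everything is a count of zeros of this function in one turn of length `2π`.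

For `ε = 0` it is a trigonometric polynomial of degree two, so it has at most four zeros in a turn,
even with multiplicity (`etaDeriv_zeros_le_four_mult`); for horizontal `v` it is a sinusoid, with at
most two (`sinusoid_zeros_le_two`). By Rolle, zeros that coalesce in a limit yield a zero of the
corresponding multiplicity, so compactness of the sphere carries both bounds to all small `ε`, the
second for small `|v₃|` (`exists_uniform_zero_bounds`). Each turn is cut at a parameter that is not
critical in the limit, so that no zero escapes at its ends.

Two cyclically consecutive maxima enclose a further critical point, so four zeros per turn give at
most `2n` maxima and two give at most `n`. The values `2n` in the vertical direction and `n` in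
nearly horizontal ones are reached because the derivative of the unperturbed height changes sign
robustly. This proves (a) and (c).

For (b), `2n` maxima force four critical points in each turn, in particular in the turn around `s =
0`, where `K^ε` equals `η` for `|s| < 3π/4`. A degenerate critical point of `η` at `s` needs `v₁ =
-2 v₃ cos³ s`, an astroid; with `v₁ ≤ 0 < v₃` this gives `cos s ≥ 0`, so inside this turn it lies
where the two curves agree. Zeros there are already zeros for `η`, and the others are near simple
zeros and persist. Hence `η` has four distinct critical points, all nondegenerate, two of them
maxima (`eventually_inheritsZeros`, `two_le_encard_eta`). -/

open scoped ContDiff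

/-! ### Critical points of height functions on `η` -/

namespace Superbridge

/-- The derivatives of orders `1, 2, 3, 4` of the height function
`s ↦ v₁ cos s + v₂ sin s + v₃ cos² s` of the curve `eta`, indexed by `0, 1, 2, 3`. -/
noncomputable def etaDeriv (v : E3) : ℕ → ℝ → ℝ
  | 0, s => -v 0 * Real.sin s + v 1 * Real.cos s - v 2 * Real.sin (2 * s)
  | 1, s => -v 0 * Real.cos s - v 1 * Real.sin s - 2 * v 2 * Real.cos (2 * s)
  | 2, s => v 0 * Real.sin s - v 1 * Real.cos s + 4 * v 2 * Real.sin (2 * s)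
  | _, s => v 0 * Real.cos s + v 1 * Real.sin s + 8 * v 2 * Real.cos (2 * s)

lemma etaDeriv_hasDerivAt (v : E3) {j : ℕ} (hj : j < 3) (s : ℝ) :
    HasDerivAt (etaDeriv v j) (etaDeriv v (j + 1) s) s := by
  have h2 : HasDerivAt (fun x : ℝ => 2 * x) 2 s := by simpa using (hasDerivAt_id s).const_mul 2
  have hs := Real.hasDerivAt_sin s
  have hc := Real.hasDerivAt_cos s
  have hs2 := h2.sin
  have hc2 := h2.cos
  interval_cases j
  · refine (((hs.const_mul (-v 0)).add (hc.const_mul (v 1))).sub (hs2.const_mul (v 2))).congr_deriv ?_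
    simp only [etaDeriv]; ring
  · refine (((hc.const_mul (-v 0)).sub (hs.const_mul (v 1))).sub
      (hc2.const_mul (2 * v 2))).congr_deriv ?_
    simp only [etaDeriv]; ring
  · refine (((hs.const_mul (v 0)).sub (hc.const_mul (v 1))).add
      (hs2.const_mul (4 * v 2))).congr_deriv ?_
    simp only [etaDeriv]; ring

lemma etaDeriv_continuous (v : E3) (j : ℕ) : Continuous (etaDeriv v j) := by
  by_cases hj : j < 3
  · exact continuous_iff_continuousAt.2 fun s => (etaDeriv_hasDerivAt v hj s).continuousAt
  · obtain ⟨k, rfl⟩ : ∃ k, j = k + 3 := ⟨j - 3, by omega⟩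
    change Continuous fun s => v 0 * Real.cos s + v 1 * Real.sin s + 8 * v 2 * Real.cos (2 * s)
    fun_prop

lemma etaDeriv_periodic (v : E3) (j : ℕ) : Function.Periodic (etaDeriv v j) (2 * Real.pi) := by
  intro s
  have e : 2 * (s + 2 * Real.pi) = 2 * s + 2 * Real.pi + 2 * Real.pi := by ring
  match j with
  | 0 => simp only [etaDeriv, e, Real.sin_add_two_pi, Real.cos_add_two_pi]
  | 1 => simp only [etaDeriv, e, Real.sin_add_two_pi, Real.cos_add_two_pi]
  | 2 => simp only [etaDeriv, e, Real.sin_add_two_pi, Real.cos_add_two_pi]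
  | (k + 3) => simp only [etaDeriv, e, Real.sin_add_two_pi, Real.cos_add_two_pi]

/-- A bound free of `s`, for uniform convergence as the direction varies; `8` is the largest
coefficient of `v 2` among the four derivatives. -/
lemma etaDeriv_sub_le (v w : E3) (j : ℕ) (s : ℝ) :
    |etaDeriv v j s - etaDeriv w j s| ≤ |v 0 - w 0| + |v 1 - w 1| + 8 * |v 2 - w 2| := by
  have key : ∀ a b c p q r : ℝ, |p| ≤ 1 → |q| ≤ 1 → |r| ≤ 8 →
      |a * p + b * q + c * r| ≤ |a| + |b| + 8 * |c| := by
    intro a b c p q r hp hq hr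
    refine (abs_add_three _ _ _).trans ?_
    rw [abs_mul, abs_mul, abs_mul]
    nlinarith [abs_nonneg a, abs_nonneg b, abs_nonneg c]
  have s1 := Real.abs_sin_le_one s
  have c1 := Real.abs_cos_le_one s
  have s2 := Real.abs_sin_le_one (2 * s)
  have c2 := Real.abs_cos_le_one (2 * s)
  have hm : ∀ k x : ℝ, |k| ≤ 8 → |x| ≤ 1 → |k * x| ≤ 8 := by
    intro k x hk hx
    rw [abs_mul]; nlinarith [abs_nonneg k, abs_nonneg x]
  match j with
  | 0 =>
    convert key (v 0 - w 0) (v 1 - w 1) (v 2 - w 2) (-Real.sin s) (Real.cos s)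
      ((-1) * Real.sin (2 * s)) (by rwa [abs_neg]) c1 (hm _ _ (by norm_num) s2) using 2
    simp only [etaDeriv]; ring
  | 1 =>
    convert key (v 0 - w 0) (v 1 - w 1) (v 2 - w 2) (-Real.cos s) (-Real.sin s)
      ((-2) * Real.cos (2 * s)) (by rwa [abs_neg]) (by rwa [abs_neg])
      (hm _ _ (by norm_num) c2) using 2
    simp only [etaDeriv]; ring
  | 2 =>
    convert key (v 0 - w 0) (v 1 - w 1) (v 2 - w 2) (Real.sin s) (-Real.cos s)
      (4 * Real.sin (2 * s)) s1 (by rwa [abs_neg]) (hm _ _ (by norm_num) s2) using 2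
    simp only [etaDeriv]; ring
  | (k + 3) =>
    convert key (v 0 - w 0) (v 1 - w 1) (v 2 - w 2) (Real.cos s) (Real.sin s)
      (8 * Real.cos (2 * s)) c1 s1 (hm _ _ (by norm_num) c2) using 2
    simp only [etaDeriv]; ring

lemma cos_sub_ne_one {s t : ℝ} (hne : s ≠ t) (h : |s - t| < 2 * Real.pi) :
    Real.cos (s - t) ≠ 1 := by
  intro hc
  rw [abs_lt] at h
  exact hne (sub_eq_zero.1 ((Real.cos_eq_one_iff_of_lt_of_lt h.1 h.2).1 hc))

lemma norm_sq_E3 (v : E3) : ‖v‖ ^ 2 = v 0 ^ 2 + v 1 ^ 2 + v 2 ^ 2 := by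
  simp [EuclideanSpace.norm_sq_eq, Fin.sum_univ_three]

/-- The critical points of the height are roots of a polynomial of degree at most four on the
unit circle. -/
lemma etaDeriv_zeros_le_four {v : E3} (hv : ‖v‖ = 1) {z : Fin 5 → ℝ}
    (hz : Function.Injective z) (hd : ∀ i j, |z i - z j| < 2 * Real.pi)
    (h0 : ∀ i, etaDeriv v 0 (z i) = 0) : False := by
  classical
  -- With `w = exp (i s)`, this is `2 i w²` times the derivative of the height.
  let P : Polynomial ℂ := Polynomial.C (-(v 2 : ℂ)) * Polynomial.X ^ 4 +
    Polynomial.C (-(v 0 : ℂ) + Complex.I * v 1) * Polynomial.X ^ 3 +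
    Polynomial.C ((v 0 : ℂ) + Complex.I * v 1) * Polynomial.X + Polynomial.C (v 2 : ℂ)
  have hroot : ∀ i, P.eval (Complex.exp (z i * Complex.I)) = 0 := by
    intro i
    have h := h0 i
    simp only [etaDeriv, Real.sin_two_mul] at h
    have hC : -(v 0 : ℂ) * Complex.sin (z i) + v 1 * Complex.cos (z i)
        - v 2 * (2 * Complex.sin (z i) * Complex.cos (z i)) = 0 := by
      exact_mod_cast congrArg (fun x : ℝ => (x : ℂ)) h
    have hsc := Complex.sin_sq_add_cos_sq (z i : ℂ)
    simp only [P, Polynomial.eval_add, Polynomial.eval_mul, Polynomial.eval_C, Polynomial.eval_pow,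
      Polynomial.eval_X]
    rw [Complex.exp_mul_I]
    set S := Complex.sin (z i : ℂ)
    set C := Complex.cos (z i : ℂ)
    have hI : Complex.I ^ 2 = -1 := Complex.I_sq
    set J := Complex.I
    have h1 : (C + S * J) * (C - S * J) = 1 := by
      linear_combination hsc - S ^ 2 * hI
    have e : -(v 2 : ℂ) * (C + S * J) ^ 4 + (-(v 0 : ℂ) + J * v 1) * (C + S * J) ^ 3
        + ((v 0 : ℂ) + J * v 1) * (C + S * J) + v 2
        = 2 * J * (C + S * J) ^ 2 * (-(v 0 : ℂ) * S + v 1 * C - v 2 * (2 * S * C)) := by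
      linear_combination (-(v 2 : ℂ) * ((C + S * J) * (C - S * J) + 1)
        - ((v 0 : ℂ) + J * v 1) * (C + S * J)) * h1
    rw [e, hC, mul_zero]
  have hP : P ≠ 0 := by
    intro hP
    have c0 : P.coeff 0 = (v 2 : ℂ) := by simp [P, Polynomial.coeff_X]
    have c1 : P.coeff 1 = (v 0 : ℂ) + Complex.I * v 1 := by
      simp only [P, Polynomial.coeff_add, Polynomial.coeff_C_mul, Polynomial.coeff_X_pow,
        Polynomial.coeff_X, Polynomial.coeff_C]
      simp
    rw [hP, Polynomial.coeff_zero] at c0 c1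
    have h2 : v 2 = 0 := by exact_mod_cast c0.symm
    have hre := congrArg Complex.re c1
    have him := congrArg Complex.im c1
    simp at hre him
    have := norm_sq_E3 v
    rw [hv, h2, ← hre, ← him] at this
    norm_num at this
  have hdeg : P.natDegree ≤ 4 := by
    simp only [P]; compute_degree
  have hinj : Function.Injective fun i => Complex.exp (z i * Complex.I) := by
    intro i j hij
    by_contra hne
    have hc := cos_sub_ne_one (hz.ne hne) (hd i j)
    apply hc
    obtain ⟨k, hk⟩ := Complex.exp_eq_exp_iff_exists_int.1 hij
    have hk' : z i - z j = k * (2 * Real.pi) := by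
      have := congrArg Complex.im hk
      simp at this
      linarith
    rw [hk']
    exact Real.cos_int_mul_two_pi k
  have hcard : (Finset.univ.image fun i => Complex.exp (z i * Complex.I)).card = 5 := by
    rw [Finset.card_image_of_injective _ hinj]; simp
  have hsub : (Finset.univ.image fun i => Complex.exp (z i * Complex.I)) ⊆ P.roots.toFinset := by
    intro w hw
    obtain ⟨i, -, rfl⟩ := Finset.mem_image.1 hw
    simp [hP, hroot i]
  have := (Finset.card_le_card hsub).trans (P.roots.toFinset_card_le.trans (P.card_roots'.trans hdeg))
  omega

/-- The parameters of the directions with a degenerate critical point lie over an astroid. -/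
lemma eq_astroid {v : E3} {s : ℝ} (h0 : etaDeriv v 0 s = 0) (h1 : etaDeriv v 1 s = 0) :
    v 0 = -2 * v 2 * Real.cos s ^ 3 ∧ v 1 = 2 * v 2 * Real.sin s ^ 3 := by
  simp only [etaDeriv, Real.sin_two_mul, Real.cos_two_mul] at h0 h1
  have hsc := Real.sin_sq_add_cos_sq s
  constructor
  · linear_combination -Real.sin s * h0 - Real.cos s * h1 +
      (-v 0 - 2 * v 2 * Real.cos s) * hsc
  · linear_combination Real.cos s * h0 - Real.sin s * h1 +
      (-v 1 - 2 * v 2 * Real.sin s) * hsc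

lemma third_ne_zero_of_astroid {v : E3} (hv : ‖v‖ = 1) {s : ℝ} (h0 : etaDeriv v 0 s = 0)
    (h1 : etaDeriv v 1 s = 0) : v 2 ≠ 0 := by
  intro h2
  obtain ⟨a, b⟩ := eq_astroid h0 h1
  have := norm_sq_E3 v
  rw [hv, a, b, h2] at this
  norm_num at this

/-- Splitting off the double zero at `s₀` leaves a shifted sinusoid, whose zeros are easy to count.
Its value at `s₀` is `(3/2) sin 2s₀`, so a triple zero occurs exactly at a cusp of the astroid. -/
lemma etaDeriv_factor {v : E3} {s₀ : ℝ} (h0 : etaDeriv v 0 s₀ = 0) (h1 : etaDeriv v 1 s₀ = 0)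
    (s : ℝ) : etaDeriv v 0 s = 2 * v 2 * (1 - Real.cos (s - s₀)) *
      (Real.sin (s + s₀) + Real.sin s₀ * Real.cos s₀) := by
  obtain ⟨a, b⟩ := eq_astroid h0 h1
  simp only [etaDeriv, Real.sin_two_mul, a, b, Real.cos_sub, Real.sin_add]
  have h1 := Real.sin_sq_add_cos_sq s
  have h2 := Real.sin_sq_add_cos_sq s₀
  generalize Real.sin s = S at *
  generalize Real.cos s = C at *
  generalize Real.sin s₀ = p at *
  generalize Real.cos s₀ = q at *
  have hS : S ^ 2 = 1 - C ^ 2 := by linarith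
  have hp : p ^ 2 = 1 - q ^ 2 := by linarith
  have hp3 : p ^ 3 = p - p * q ^ 2 := by linear_combination p * hp
  ring_nf
  simp only [hS, hp, hp3]
  ring

/-- The second factor has at most two zeros in a period. -/
lemma sin_add_no_three {s₀ c x y w : ℝ} (hxy : x ≠ y) (hxw : x ≠ w) (hyw : y ≠ w)
    (dxy : |x - y| < 2 * Real.pi) (dxw : |x - w| < 2 * Real.pi) (dyw : |y - w| < 2 * Real.pi)
    (hx : Real.sin (x + s₀) + c = 0) (hy : Real.sin (y + s₀) + c = 0)
    (hw : Real.sin (w + s₀) + c = 0) : False := by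
  have e1 : Real.sin (x + s₀) = Real.sin (y + s₀) := by linarith
  have e2 : Real.sin (x + s₀) = Real.sin (w + s₀) := by linarith
  have key : ∀ {a b : ℝ}, a ≠ b → |a - b| < 2 * Real.pi →
      Real.sin (a + s₀) = Real.sin (b + s₀) → ∃ k : ℤ, b + s₀ = (2 * k + 1) * Real.pi - (a + s₀) := by
    intro a b hne hd he
    obtain ⟨k, hk | hk⟩ := Real.sin_eq_sin_iff.1 he
    · exfalso
      apply cos_sub_ne_one hne hd
      have : a - b = ((-k : ℤ) : ℝ) * (2 * Real.pi) := by push_cast; linarith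
      rw [this]; exact Real.cos_int_mul_two_pi _
    · exact ⟨k, hk⟩
  obtain ⟨k, hk⟩ := key hxy dxy e1
  obtain ⟨l, hl⟩ := key hxw dxw e2
  apply cos_sub_ne_one hyw dyw
  have : y - w = ((k - l : ℤ) : ℝ) * (2 * Real.pi) := by push_cast; linarith
  rw [this]; exact Real.cos_int_mul_two_pi _

lemma factor_zero_of_astroid {v : E3} (hv : ‖v‖ = 1) {s₀ s : ℝ} (h0 : etaDeriv v 0 s₀ = 0)
    (h1 : etaDeriv v 1 s₀ = 0) (hs : etaDeriv v 0 s = 0) (hne : s ≠ s₀)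
    (hd : |s - s₀| < 2 * Real.pi) :
    Real.sin (s + s₀) + Real.sin s₀ * Real.cos s₀ = 0 := by
  rw [etaDeriv_factor h0 h1] at hs
  have := third_ne_zero_of_astroid hv h0 h1
  have h3 : (1 - Real.cos (s - s₀)) ≠ 0 := sub_ne_zero.2 (cos_sub_ne_one hne hd).symm
  simpa [this, h3] using hs

lemma sin_two_mul_eq_zero_of_cusp {v : E3} (hv : ‖v‖ = 1) {s₀ : ℝ} (h0 : etaDeriv v 0 s₀ = 0)
    (h1 : etaDeriv v 1 s₀ = 0) (h2 : etaDeriv v 2 s₀ = 0) : Real.sin (2 * s₀) = 0 := by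
  have hne := third_ne_zero_of_astroid hv h0 h1
  simp only [etaDeriv] at h0 h2
  have : v 2 * Real.sin (2 * s₀) = 0 := by linarith
  simpa [hne] using this

lemma not_all_etaDeriv_zero {v : E3} (hv : ‖v‖ = 1) {s₀ : ℝ} (h0 : etaDeriv v 0 s₀ = 0)
    (h1 : etaDeriv v 1 s₀ = 0) (h2 : etaDeriv v 2 s₀ = 0) (h3 : etaDeriv v 3 s₀ = 0) : False := by
  have hne := third_ne_zero_of_astroid hv h0 h1
  have hs := sin_two_mul_eq_zero_of_cusp hv h0 h1 h2
  simp only [etaDeriv] at h1 h3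
  have : v 2 * Real.cos (2 * s₀) = 0 := by linarith
  have hc : Real.cos (2 * s₀) = 0 := by simpa [hne] using this
  have := Real.sin_sq_add_cos_sq (2 * s₀)
  rw [hs, hc] at this
  norm_num at this

/-- Four distinct critical points in a period are nondegenerate. -/
lemma simple_of_four_zeros {v : E3} (hv : ‖v‖ = 1) {z : Fin 4 → ℝ}
    (hz : Function.Injective z) (hd : ∀ i j, |z i - z j| < 2 * Real.pi)
    (h0 : ∀ i, etaDeriv v 0 (z i) = 0) (i : Fin 4) : etaDeriv v 1 (z i) ≠ 0 := by
  intro h1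
  have key : ∀ j, j ≠ i → Real.sin (z j + z i) + Real.sin (z i) * Real.cos (z i) = 0 :=
    fun j hj => factor_zero_of_astroid hv (h0 i) h1 (h0 j) (hz.ne hj) (hd j i)
  obtain ⟨a, b, c, ha, hb, hc, hab, hac, hbc⟩ :
      ∃ a b c : Fin 4, a ≠ i ∧ b ≠ i ∧ c ≠ i ∧ a ≠ b ∧ a ≠ c ∧ b ≠ c := by
    clear key h1
    revert i; decide
  exact sin_add_no_three (hz.ne hab) (hz.ne hac) (hz.ne hbc) (hd _ _) (hd _ _) (hd _ _)
    (key a ha) (key b hb) (key c hc)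

/-- There are at most four critical points in a period, counted with multiplicity. -/
lemma etaDeriv_zeros_le_four_mult {v : E3} (hv : ‖v‖ = 1) {τ : Fin 5 → ℝ}
    (hd : ∀ i j, |τ i - τ j| < 2 * Real.pi)
    (h0 : ∀ i, etaDeriv v 0 (τ i) = 0)
    (h1 : ∀ i j, i < j → τ i = τ j → etaDeriv v 1 (τ i) = 0)
    (h2 : ∀ i j k, i < j → j < k → τ i = τ j → τ i = τ k → etaDeriv v 2 (τ i) = 0)
    (h3 : ∀ i j k l, i < j → j < k → k < l → τ i = τ j → τ i = τ k → τ i = τ l →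
      etaDeriv v 3 (τ i) = 0) : False := by
  classical
  by_cases hinj : Function.Injective τ
  · exact etaDeriv_zeros_le_four hv hinj hd h0
  obtain ⟨i, j, hlt, hij⟩ : ∃ i j, i < j ∧ τ i = τ j := by
    simp only [Function.Injective, not_forall] at hinj
    obtain ⟨i, j, h, hne⟩ := hinj
    rcases lt_or_gt_of_ne hne with h' | h'
    · exact ⟨i, j, h', h⟩
    · exact ⟨j, i, h', h.symm⟩
  have hs0 := h0 i
  have hs1 := h1 i j hlt hij
  -- There is only one multiple zero: a point of the astroid determines `cos³` and `sin³` of its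
  -- parameter, and cubing is injective on the reals.
  have hother : ∀ {k l}, k < l → τ k = τ l → τ k = τ i := by
    intro k l hkl he
    by_contra hne
    obtain ⟨a1, b1⟩ := eq_astroid (h0 k) (h1 k l hkl he)
    obtain ⟨a2, b2⟩ := eq_astroid hs0 hs1
    have hv2 := third_ne_zero_of_astroid hv hs0 hs1
    have hc : Real.cos (τ k) ^ 3 = Real.cos (τ i) ^ 3 := by
      have : v 2 * (Real.cos (τ k) ^ 3 - Real.cos (τ i) ^ 3) = 0 := by linarith
      simpa [hv2, sub_eq_zero] using this
    have hs : Real.sin (τ k) ^ 3 = Real.sin (τ i) ^ 3 := by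
      have : v 2 * (Real.sin (τ k) ^ 3 - Real.sin (τ i) ^ 3) = 0 := by linarith
      simpa [hv2, sub_eq_zero] using this
    have hodd : Odd 3 := by decide
    have hc' := hodd.strictMono_pow.injective hc
    have hs' := hodd.strictMono_pow.injective hs
    apply cos_sub_ne_one hne (hd k i)
    rw [Real.cos_sub, hc', hs']
    linarith [Real.sin_sq_add_cos_sq (τ i)]
  set s₀ := τ i with hs₀
  let A := Finset.univ.filter fun k => τ k = s₀
  have hA : ∀ k, k ∈ A ↔ τ k = s₀ := by simp [A]
  let B := Finset.univ.filter fun k => ¬ τ k = s₀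
  have hB : ∀ k, k ∈ B ↔ τ k ≠ s₀ := by simp [B]
  have hAB : A.card + B.card = 5 := by
    have := Finset.card_filter_add_card_filter_not (s := (Finset.univ : Finset (Fin 5)))
      (fun k => τ k = s₀)
    simpa [A, B] using this
  have hinjB : ∀ k ∈ B, ∀ l ∈ B, k ≠ l → τ k ≠ τ l := by
    intro k hk l hl hne he
    rcases lt_or_gt_of_ne hne with h' | h'
    · exact (hB k).1 hk (hother h' he)
    · exact (hB l).1 hl (hother h' he.symm)
  have hq : ∀ k ∈ B, Real.sin (τ k + s₀) + Real.sin s₀ * Real.cos s₀ = 0 := fun k hk =>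
    factor_zero_of_astroid hv hs0 hs1 (h0 k) ((hB k).1 hk) (hd k i)
  -- `A.card` is the multiplicity of `s₀`. If it is at most two, the remaining factor has three
  -- zeros; if three, `s₀` is a cusp and is itself a third zero of that factor; if four or more, all
  -- four derivatives vanish at `s₀`.
  by_cases hA3 : A.card ≤ 2
  · obtain ⟨a, ha, b, hb, c, hc, hab, hac, hbc⟩ := Finset.two_lt_card.1 (show 2 < B.card by omega)
    exact sin_add_no_three (hinjB a ha b hb hab) (hinjB a ha c hc hac) (hinjB b hb c hc hbc)
      (hd _ _) (hd _ _) (hd _ _) (hq a ha) (hq b hb) (hq c hc)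
  push Not at hA3
  have hs2 : etaDeriv v 2 s₀ = 0 := by
    let e := A.orderEmbOfCardLe (k := 3) hA3
    have he : ∀ k, τ (e k) = s₀ := fun k => (hA _).1 (A.orderEmbOfCardLe_mem hA3 k)
    have := h2 (e 0) (e 1) (e 2) (e.strictMono (by decide)) (e.strictMono (by decide))
      (by rw [he, he]) (by rw [he, he])
    rwa [he] at this
  have hcusp := sin_two_mul_eq_zero_of_cusp hv hs0 hs1 hs2
  by_cases hA4 : A.card ≤ 3
  · obtain ⟨a, ha, b, hb, hab⟩ := Finset.one_lt_card.1 (show 1 < B.card by omega)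
    refine sin_add_no_three (hinjB a ha b hb hab) ((hB a).1 ha) ((hB b).1 hb)
      (hd _ _) (hd _ i) (hd _ i) (hq a ha) (hq b hb) ?_
    have e : s₀ + s₀ = 2 * s₀ := by ring
    rw [e, hcusp]
    rw [Real.sin_two_mul] at hcusp
    linarith
  push Not at hA4
  have hs3 : etaDeriv v 3 s₀ = 0 := by
    let e := A.orderEmbOfCardLe (k := 4) hA4
    have he : ∀ k, τ (e k) = s₀ := fun k => (hA _).1 (A.orderEmbOfCardLe_mem hA4 k)
    have := h3 (e 0) (e 1) (e 2) (e 3) (e.strictMono (by decide)) (e.strictMono (by decide))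
      (e.strictMono (by decide)) (by rw [he, he]) (by rw [he, he]) (by rw [he, he])
    rwa [he] at this
  exact not_all_etaDeriv_zero hv hs0 hs1 hs2 hs3

/-- A nonzero sinusoid has at most two zeros, all simple, in an open period. -/
lemma sinusoid_zeros_le_two {v : E3} (hv : ‖v‖ = 1) (hv2 : v 2 = 0) {τ : Fin 3 → ℝ}
    (hmono : Monotone τ) (hd : ∀ i j, |τ i - τ j| < 2 * Real.pi)
    (h0 : ∀ i, etaDeriv v 0 (τ i) = 0)
    (h1 : ∀ i j, i < j → τ i = τ j → etaDeriv v 1 (τ i) = 0) : False := by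
  have hne : ∀ i j, i < j → τ i < τ j := by
    intro i j hij
    refine lt_of_le_of_ne (hmono hij.le) fun he => ?_
    exact third_ne_zero_of_astroid hv (h0 i) (h1 i j hij he) hv2
  have hsin : ∀ i j, Real.sin (τ j - τ i) = 0 := by
    intro i j
    have hi := h0 i
    have hj := h0 j
    simp only [etaDeriv, hv2] at hi hj
    have hn := norm_sq_E3 v
    rw [hv, hv2] at hn
    rw [Real.sin_sub]
    have e1 : v 0 * (Real.sin (τ j) * Real.cos (τ i) - Real.cos (τ j) * Real.sin (τ i)) = 0 := by
      linear_combination Real.cos (τ j) * hi - Real.cos (τ i) * hj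
    have e2 : v 1 * (Real.sin (τ j) * Real.cos (τ i) - Real.cos (τ j) * Real.sin (τ i)) = 0 := by
      linear_combination Real.sin (τ j) * hi - Real.sin (τ i) * hj
    linear_combination v 0 * e1 + v 1 * e2 +
      (Real.sin (τ j) * Real.cos (τ i) - Real.cos (τ j) * Real.sin (τ i)) * hn
  -- Distinct zeros are at least `π` apart, so three of them do not fit in an open interval of
  -- length `2π`.
  have hpi : ∀ i j, i < j → Real.pi ≤ τ j - τ i := by
    intro i j hij
    by_contra hlt
    push Not at hlt
    exact (Real.sin_pos_of_pos_of_lt_pi (sub_pos.2 (hne i j hij)) hlt).ne' (hsin i j)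
  have a := hpi 0 1 (by decide)
  have b := hpi 1 2 (by decide)
  have c := (abs_lt.1 (hd 2 0)).2
  linarith

end Superbridge

/-! ### Limits of zeros under perturbation -/

namespace Superbridge

open Filter Topology Set

/-- Counterexamples near a limit parameter are followed along an ultrafilter, on which zeros
confined to a compact interval converge without passing to subsequences. -/
lemma exists_ultrafilter_of_frequently {α : Type*} {l : Filter α} {p : α → Prop}
    (h : ∃ᶠ x in l, p x) : ∃ U : Ultrafilter α, (U : Filter α) ≤ l ∧ ∀ᶠ x in U, p x := by
  have : (l ⊓ 𝓟 {x | p x}).NeBot := frequently_mem_iff_neBot.1 h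
  exact ⟨Ultrafilter.of (l ⊓ 𝓟 {x | p x}), (Ultrafilter.of_le _).trans inf_le_left,
    (Ultrafilter.of_le _).trans inf_le_right (mem_principal_self _)⟩

section Limits

variable {ι : Type*} {U : Filter ι} {h : ι → ℕ → ℝ → ℝ} {g : ℕ → ℝ → ℝ}

/-- Rolle's theorem for zeros that depend on a parameter and have a common limit. -/
lemma exists_zero_between_of_tendsto {j : ℕ}
    (hder : ∀ i s, HasDerivAt (h i j) (h i (j + 1) s) s)
    {ξ ξ' : ι → ℝ} {x : ℝ} (hξ : Tendsto ξ U (𝓝 x)) (hξ' : Tendsto ξ' U (𝓝 x))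
    (hlt : ∀ᶠ i in U, ξ i < ξ' i) (hz : ∀ᶠ i in U, h i j (ξ i) = 0)
    (hz' : ∀ᶠ i in U, h i j (ξ' i) = 0) :
    ∃ ζ : ι → ℝ, Tendsto ζ U (𝓝 x) ∧ (∀ᶠ i in U, ξ i < ζ i ∧ ζ i < ξ' i) ∧
      ∀ᶠ i in U, h i (j + 1) (ζ i) = 0 := by
  have key : ∀ i, ∃ ζ, (ξ i < ξ' i → h i j (ξ i) = 0 → h i j (ξ' i) = 0 →
      (ξ i < ζ ∧ ζ < ξ' i) ∧ h i (j + 1) ζ = 0) := by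
    intro i
    by_cases hc : ξ i < ξ' i ∧ h i j (ξ i) = 0 ∧ h i j (ξ' i) = 0
    · obtain ⟨a, b, c⟩ := hc
      obtain ⟨ζ, hζ, h0⟩ := exists_hasDerivAt_eq_zero a
        (fun s _ => (hder i s).continuousAt.continuousWithinAt) (b.trans c.symm)
        (fun s _ => hder i s)
      exact ⟨ζ, fun _ _ _ => ⟨hζ, h0⟩⟩
    · exact ⟨0, fun a b c => absurd ⟨a, b, c⟩ hc⟩
  choose ζ hζ using key
  have hall : ∀ᶠ i in U, (ξ i < ζ i ∧ ζ i < ξ' i) ∧ h i (j + 1) (ζ i) = 0 := by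
    filter_upwards [hlt, hz, hz'] with i a b c using hζ i a b c
  refine ⟨ζ, ?_, hall.mono fun _ h => h.1, hall.mono fun _ h => h.2⟩
  exact tendsto_of_tendsto_of_tendsto_of_le_of_le' hξ hξ'
    (hall.mono fun _ h => h.1.1.le) (hall.mono fun _ h => h.1.2.le)

lemma eq_zero_of_tendsto_zeros [U.NeBot] {j : ℕ} (hg : Continuous (g j))
    (hunif : TendstoUniformly (fun i => h i j) (g j) U) {ξ : ι → ℝ} {x : ℝ}
    (hξ : Tendsto ξ U (𝓝 x)) (hz : ∀ᶠ i in U, h i j (ξ i) = 0) : g j x = 0 := by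
  have h1 := hunif.tendsto_comp hg.continuousAt hξ
  have h2 : Tendsto (fun i => h i j (ξ i)) U (𝓝 0) :=
    (tendsto_congr' (hz.mono fun i hi => hi)).2 tendsto_const_nhds
  exact tendsto_nhds_unique h1 h2

/-- Zeros of a convergent family of functions converge to zeros with at least the multiplicity given
by the number of zeros that coalesce (here up to four). -/
lemma exists_limit_zeros {U : Ultrafilter ι} {m : ℕ}
    (hder : ∀ i, ∀ j < 3, ∀ s, HasDerivAt (h i j) (h i (j + 1) s) s)
    (hg : ∀ j, Continuous (g j))
    (hunif : ∀ j ≤ 3, TendstoUniformly (fun i => h i j) (g j) U)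
    {z : ι → Fin m → ℝ} {b c : ℝ} (hmono : ∀ᶠ i in U, StrictMono (z i))
    (hmem : ∀ᶠ i in U, ∀ l, z i l ∈ Icc b c) (hz : ∀ᶠ i in U, ∀ l, h i 0 (z i l) = 0) :
    ∃ τ : Fin m → ℝ, (∀ l, Tendsto (fun i => z i l) U (𝓝 (τ l))) ∧ Monotone τ ∧
      (∀ l, τ l ∈ Icc b c) ∧ (∀ l, g 0 (τ l) = 0) ∧
      (∀ i j, i < j → τ i = τ j → g 1 (τ i) = 0) ∧
      (∀ i j k, i < j → j < k → τ i = τ j → τ i = τ k → g 2 (τ i) = 0) ∧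
      (∀ i j k l, i < j → j < k → k < l → τ i = τ j → τ i = τ k → τ i = τ l →
        g 3 (τ i) = 0) := by
  have hlim : ∀ l, ∃ t ∈ Icc b c, Tendsto (fun i => z i l) U (𝓝 t) := by
    intro l
    obtain ⟨t, ht, hle⟩ := (isCompact_Icc (a := b) (b := c)).ultrafilter_le_nhds
      (U.map fun i => z i l) (by
        rw [le_principal_iff]
        exact hmem.mono fun i hi => hi l)
    exact ⟨t, ht, hle⟩
  choose τ hτm hτ using hlim
  have hz' : ∀ l, ∀ᶠ i in (U : Filter ι), h i 0 (z i l) = 0 := fun l => hz.mono fun i hi => hi l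
  have hlt : ∀ {k l}, k < l → ∀ᶠ i in (U : Filter ι), z i k < z i l := fun hkl =>
    hmono.mono fun i hi => hi hkl
  refine ⟨τ, hτ, ?_, hτm, fun l => eq_zero_of_tendsto_zeros (hg 0) (hunif 0 (by norm_num)) (hτ l)
    (hz' l), ?_, ?_, ?_⟩
  · intro k l hkl
    exact le_of_tendsto_of_tendsto (hτ k) (hτ l) (hmono.mono fun i hi => hi.monotone hkl)
  · intro i j hij e
    obtain ⟨ζ, a, -, c⟩ := exists_zero_between_of_tendsto (fun i s => hder i 0 (by norm_num) s)
      (hτ i) (e ▸ hτ j) (hlt hij) (hz' i) (hz' j)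
    exact eq_zero_of_tendsto_zeros (hg 1) (hunif 1 (by norm_num)) a c
  · intro i j k hij hjk e1 e2
    obtain ⟨ζ, a, b, c⟩ := exists_zero_between_of_tendsto (fun i s => hder i 0 (by norm_num) s)
      (hτ i) (e1 ▸ hτ j) (hlt hij) (hz' i) (hz' j)
    obtain ⟨ζ', a', b', c'⟩ := exists_zero_between_of_tendsto (fun i s => hder i 0 (by norm_num) s)
      (e1 ▸ hτ j) (e2 ▸ hτ k) (hlt hjk) (hz' j) (hz' k)
    -- The middle zero separates `ζ` from `ζ'`, so Rolle applies once more to the derivative.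
    obtain ⟨χ, p, -, q⟩ := exists_zero_between_of_tendsto (fun i s => hder i 1 (by norm_num) s)
      a a' (by filter_upwards [b, b'] with i x y using x.2.trans y.1) c c'
    exact eq_zero_of_tendsto_zeros (hg 2) (hunif 2 (by norm_num)) p q
  · intro i j k l hij hjk hkl e1 e2 e3
    obtain ⟨ζ, a, b, c⟩ := exists_zero_between_of_tendsto (fun i s => hder i 0 (by norm_num) s)
      (hτ i) (e1 ▸ hτ j) (hlt hij) (hz' i) (hz' j)
    obtain ⟨ζ', a', b', c'⟩ := exists_zero_between_of_tendsto (fun i s => hder i 0 (by norm_num) s)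
      (e1 ▸ hτ j) (e2 ▸ hτ k) (hlt hjk) (hz' j) (hz' k)
    obtain ⟨ζ₂, a₂, b₂, c₂⟩ := exists_zero_between_of_tendsto (fun i s => hder i 0 (by norm_num) s)
      (e2 ▸ hτ k) (e3 ▸ hτ l) (hlt hkl) (hz' k) (hz' l)
    obtain ⟨χ, p, r, q⟩ := exists_zero_between_of_tendsto (fun i s => hder i 1 (by norm_num) s)
      a a' (by filter_upwards [b, b'] with i x y using x.2.trans y.1) c c'
    obtain ⟨χ', p', r', q'⟩ := exists_zero_between_of_tendsto (fun i s => hder i 1 (by norm_num) s)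
      a' a₂ (by filter_upwards [b', b₂] with i x y using x.2.trans y.1) c' c₂
    obtain ⟨θ, u, -, w⟩ := exists_zero_between_of_tendsto (fun i s => hder i 2 (by norm_num) s)
      p p' (by filter_upwards [r, r'] with i x y using x.2.trans y.1) q q'
    exact eq_zero_of_tendsto_zeros (hg 3) (hunif 3 (by norm_num)) u w

end Limits

/-- A simple zero persists under perturbation. -/
lemma exists_tendsto_zero_of_simple {ι : Type*} {U : Filter ι} {V : ι → E3} {v₀ : E3}
    (hV : Tendsto V U (𝓝 v₀)) {t : ℝ} (h0 : etaDeriv v₀ 0 t = 0) (h1 : etaDeriv v₀ 1 t ≠ 0) :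
    ∃ u : ι → ℝ, Tendsto u U (𝓝 t) ∧ ∀ᶠ i in U, etaDeriv (V i) 0 (u i) = 0 := by
  have hd := etaDeriv_hasDerivAt v₀ (j := 0) (by norm_num) t
  have hcont : ∀ s, Tendsto (fun i => etaDeriv (V i) 0 s) U (𝓝 (etaDeriv v₀ 0 s)) := by
    intro s
    have hc : Continuous fun v : E3 => etaDeriv v 0 s := by simp only [etaDeriv]; fun_prop
    exact (hc.tendsto v₀).comp hV
  have hex : ∀ r > 0, ∀ᶠ i in U, ∃ s, dist s t < r ∧ etaDeriv (V i) 0 s = 0 := by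
    intro r hr
    have hball : Metric.ball t r ∈ 𝓝 t := Metric.ball_mem_nhds t hr
    -- Without a negative value nearby, `t` would be a local minimum of the function and its
    -- derivative there would vanish.
    obtain ⟨s₁, hs₁, hn⟩ : ∃ s ∈ Metric.ball t r, etaDeriv v₀ 0 s < 0 := by
      by_contra! hcon
      have hmin : IsLocalMin (etaDeriv v₀ 0) t := by
        filter_upwards [hball] with s hs
        rw [h0]; exact hcon s hs
      exact h1 (hmin.hasDerivAt_eq_zero hd)
    obtain ⟨s₂, hs₂, hp⟩ : ∃ s ∈ Metric.ball t r, 0 < etaDeriv v₀ 0 s := by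
      by_contra! hcon
      have hmax : IsLocalMax (etaDeriv v₀ 0) t := by
        filter_upwards [hball] with s hs
        rw [h0]; exact hcon s hs
      exact h1 (hmax.hasDerivAt_eq_zero hd)
    filter_upwards [(hcont s₁).eventually (gt_mem_nhds hn), (hcont s₂).eventually (lt_mem_nhds hp)]
      with i h1 h2
    have hsub : uIcc s₁ s₂ ⊆ Metric.ball t r := by
      rw [Real.ball_eq_Ioo] at hs₁ hs₂ ⊢
      exact (ordConnected_Ioo).uIcc_subset hs₁ hs₂
    obtain ⟨s, hs, hs0⟩ := intermediate_value_uIcc ((etaDeriv_continuous (V i) 0).continuousOn)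
      (show (0 : ℝ) ∈ uIcc (etaDeriv (V i) 0 s₁) (etaDeriv (V i) 0 s₂) from
        mem_uIcc_of_le h1.le h2.le)
    exact ⟨s, hsub hs, hs0⟩
  -- Taking the zero nearest to `t` gives one choice that works for every radius, hence converges.
  have hnear : ∀ i, ∃ u, ∀ s, etaDeriv (V i) 0 s = 0 →
      etaDeriv (V i) 0 u = 0 ∧ dist u t ≤ dist s t := by
    intro i
    by_cases hne : {s | etaDeriv (V i) 0 s = 0}.Nonempty
    · have hcl : IsClosed {s | etaDeriv (V i) 0 s = 0} :=
        isClosed_eq (etaDeriv_continuous (V i) 0) continuous_const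
      obtain ⟨u, hu, hd⟩ := hcl.exists_infDist_eq_dist hne t
      refine ⟨u, fun s hs => ⟨hu, ?_⟩⟩
      rw [dist_comm u, ← hd, dist_comm s]
      exact Metric.infDist_le_dist_of_mem hs
    · exact ⟨0, fun s hs => absurd ⟨s, hs⟩ hne⟩
  choose u hu using hnear
  refine ⟨u, ?_, ?_⟩
  · rw [Metric.tendsto_nhds]
    intro r hr
    filter_upwards [hex r hr] with i ⟨s, hs, h0⟩ using ((hu i s h0).2).trans_lt hs
  · filter_upwards [hex 1 one_pos] with i ⟨s, _, h0⟩ using (hu i s h0).1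

/-- Five equally spaced points cannot all be critical. The window for `a` keeps the turn `(a - 2π,
a)` within `|s| < 5π/4`, where `cos` is negative once `|s| ≥ 3π/4`. -/
lemma exists_regular_cut {v : E3} (hv : ‖v‖ = 1) :
    ∃ a ∈ Ioo (3 * Real.pi / 4) (5 * Real.pi / 4), etaDeriv v 0 a ≠ 0 := by
  by_contra! hcon
  have hpi := Real.pi_pos
  let z : Fin 5 → ℝ := fun l => 3 * Real.pi / 4 + ((l : ℕ) + 1) * (Real.pi / 12)
  have hz : ∀ l, z l ∈ Ioo (3 * Real.pi / 4) (5 * Real.pi / 4) := by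
    intro l
    have h1 : ((l : ℕ) : ℝ) ≤ 4 := by exact_mod_cast Nat.lt_succ_iff.1 l.2
    have h0 : (0 : ℝ) ≤ ((l : ℕ) : ℝ) := Nat.cast_nonneg _
    constructor <;> simp only [z] <;> nlinarith
  refine etaDeriv_zeros_le_four hv (z := z) ?_ ?_ fun i => hcon _ (hz i)
  · intro i j hij
    simp only [z, add_right_inj] at hij
    have := mul_right_cancel₀ (by positivity) hij
    exact Fin.ext (by exact_mod_cast add_right_cancel this)
  · intro i j
    have a := hz i
    have b := hz j
    rw [abs_lt]
    constructor <;> linarith [a.1, a.2, b.1, b.2]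

/-- The derivatives of the height function of a perturbation of `eta`; the perturbation has
derivatives `E v`. -/
noncomputable def pertDeriv (E : E3 → ℕ → ℝ → ℝ) (ε : ℝ) (v : E3) (j : ℕ) (s : ℝ) : ℝ :=
  etaDeriv v j s + ε * E v j s

/-- Convergence of the zeros in one turn of the perturbed curve as the parameters tend to a limit. -/
lemma exists_limit_zeros_pert {E : E3 → ℕ → ℝ → ℝ} {C : ℝ}
    (hE : ∀ v j s, HasDerivAt (E v j) (E v (j + 1) s) s)
    (hC : ∀ v : E3, ‖v‖ = 1 → ∀ j ≤ 3, ∀ s, |E v j s| ≤ C)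
    {ι : Type*} {U : Ultrafilter ι} {e : ι → ℝ} {V : ι → E3} {v₀ : E3}
    (he : Tendsto e U (𝓝 0)) (hV : Tendsto V U (𝓝 v₀)) (hV1 : ∀ᶠ i in U, ‖V i‖ = 1)
    {a : ℝ} (ha : etaDeriv v₀ 0 a ≠ 0) {m : ℕ} {J : ι → ℤ} {z : ι → Fin m → ℝ}
    (hmono : ∀ᶠ i in U, StrictMono (z i))
    (hmem : ∀ᶠ i in U, ∀ l, z i l ∈ Icc (a - 2 * Real.pi + J i * (2 * Real.pi))
      (a + J i * (2 * Real.pi)))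
    (hz : ∀ᶠ i in U, ∀ l, pertDeriv E (e i) (V i) 0 (z i l) = 0) :
    ∃ τ : Fin m → ℝ, (∀ l, Tendsto (fun i => z i l - J i * (2 * Real.pi)) U (𝓝 (τ l))) ∧
      Monotone τ ∧ (∀ l, τ l ∈ Ioo (a - 2 * Real.pi) a) ∧ (∀ l, etaDeriv v₀ 0 (τ l) = 0) ∧
      (∀ i j, i < j → τ i = τ j → etaDeriv v₀ 1 (τ i) = 0) ∧
      (∀ i j k, i < j → j < k → τ i = τ j → τ i = τ k → etaDeriv v₀ 2 (τ i) = 0) ∧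
      (∀ i j k l, i < j → j < k → k < l → τ i = τ j → τ i = τ k → τ i = τ l →
        etaDeriv v₀ 3 (τ i) = 0) := by
  -- Translating turn `J i` to a fixed interval leaves `etaDeriv` unchanged. The perturbation may
  -- differ from turn to turn, but only its uniform bound matters.
  let h : ι → ℕ → ℝ → ℝ := fun i j s => pertDeriv E (e i) (V i) j (s + J i * (2 * Real.pi))
  have hder : ∀ i, ∀ j < 3, ∀ s, HasDerivAt (h i j) (h i (j + 1) s) s := by
    intro i j hj s
    have h1 : HasDerivAt (pertDeriv E (e i) (V i) j)
        (pertDeriv E (e i) (V i) (j + 1) (s + J i * (2 * Real.pi))) (s + J i * (2 * Real.pi)) :=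
      (etaDeriv_hasDerivAt (V i) hj _).add ((hE (V i) j _).const_mul (e i))
    exact h1.comp_add_const s _
  have hunif : ∀ j ≤ 3, TendstoUniformly (fun i => h i j) (etaDeriv v₀ j) U := by
    intro j hj
    have hB : Tendsto (fun i => |V i 0 - v₀ 0| + |V i 1 - v₀ 1| + 8 * |V i 2 - v₀ 2| + |e i| * C) U
        (𝓝 0) := by
      have hc : ∀ k : Fin 3, Tendsto (fun i => V i k) U (𝓝 (v₀ k)) := fun k =>
        ((by fun_prop : Continuous fun v : E3 => v k).tendsto v₀).comp hV
      have hk : ∀ k : Fin 3, Tendsto (fun i => |V i k - v₀ k|) U (𝓝 0) := fun k => by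
        simpa using ((hc k).sub_const (v₀ k)).abs
      have := (((hk 0).add (hk 1)).add ((hk 2).const_mul 8)).add ((he.abs).mul_const C)
      simpa using this
    rw [Metric.tendstoUniformly_iff]
    intro r hr
    filter_upwards [hB.eventually (gt_mem_nhds hr), hV1] with i hi hi1 s
    refine lt_of_le_of_lt ?_ hi
    rw [dist_comm, Real.dist_eq]
    have hper : etaDeriv v₀ j s = etaDeriv v₀ j (s + J i * (2 * Real.pi)) :=
      ((etaDeriv_periodic v₀ j).int_mul (J i) s).symm
    rw [hper]
    have e1 := etaDeriv_sub_le (V i) v₀ j (s + J i * (2 * Real.pi))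
    have e2 : |e i * E (V i) j (s + J i * (2 * Real.pi))| ≤ |e i| * C := by
      rw [abs_mul]
      exact mul_le_mul_of_nonneg_left (hC _ hi1 j hj _) (abs_nonneg _)
    calc |h i j s - etaDeriv v₀ j (s + J i * (2 * Real.pi))|
        = |(etaDeriv (V i) j (s + J i * (2 * Real.pi)) - etaDeriv v₀ j (s + J i * (2 * Real.pi)))
            + e i * E (V i) j (s + J i * (2 * Real.pi))| := by
          simp only [h, pertDeriv]; ring_nf
      _ ≤ _ := (abs_add_le _ _).trans (add_le_add e1 e2)
  obtain ⟨τ, h1, h2, h3, h4, h5⟩ := exists_limit_zeros (U := U) (h := h) (g := etaDeriv v₀)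
    (z := fun i l => z i l - J i * (2 * Real.pi)) (b := a - 2 * Real.pi) (c := a) hder
    (etaDeriv_continuous v₀) hunif
    (hmono.mono fun i hi k l hkl => sub_lt_sub_right (hi hkl) _)
    (hmem.mono fun i hi l => ⟨by linarith [(hi l).1], by linarith [(hi l).2]⟩)
    (hz.mono fun i hi l => by simpa [h] using hi l)
  -- Limits of zeros avoid both ends of the turn, since neither is a zero of the limit function.
  refine ⟨τ, h1, h2, fun l => ⟨lt_of_le_of_ne (h3 l).1 ?_, lt_of_le_of_ne (h3 l).2 ?_⟩, h4, h5⟩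
  · intro hl
    apply ha
    rw [← h4 l, ← hl]
    exact ((etaDeriv_periodic v₀ 0).sub_eq a).symm
  · intro hl
    exact ha (hl ▸ h4 l)

/-! ### Zero counts uniform in the direction -/

section Local

variable {E : E3 → ℕ → ℝ → ℝ} {C : ℝ}

/-- `H` has no `m` zeros in one turn, where the turns start at `a` modulo `2π`. -/
def FewZeros (m : ℕ) (H : ℝ → ℝ) (a : ℝ) : Prop :=
  ∀ (J : ℤ) (z : Fin m → ℝ), StrictMono z →
    (∀ l, z l ∈ Icc (a - 2 * Real.pi + J * (2 * Real.pi)) (a + J * (2 * Real.pi))) →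
    ¬ ∀ l, H (z l) = 0

/-- If `H` has four zeros in the turn that ends at `a`, then so has `G`. -/
def InheritsZeros (H G : ℝ → ℝ) (a : ℝ) : Prop :=
  ∀ z : Fin 4 → ℝ, StrictMono z → (∀ l, z l ∈ Icc (a - 2 * Real.pi) a) → (∀ l, H (z l) = 0) →
    ∃ u : Fin 4 → ℝ, Function.Injective u ∧ (∀ l, u l ∈ Ioo (a - 2 * Real.pi) a) ∧
      ∀ l, G (u l) = 0

lemma abs_sub_lt_of_mem_Ioo {a p x y : ℝ} (hx : x ∈ Ioo (a - p) a) (hy : y ∈ Ioo (a - p) a) :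
    |x - y| < p := by
  rw [abs_lt]
  constructor <;> linarith [hx.1, hx.2, hy.1, hy.2]

/-- Five zeros in a turn for parameters arbitrarily close to the limit would converge to five zeros
of `etaDeriv v₀ 0`, counted with multiplicity. -/
lemma eventually_fewZeros_five (hE : ∀ v j s, HasDerivAt (E v j) (E v (j + 1) s) s)
    (hC : ∀ v : E3, ‖v‖ = 1 → ∀ j ≤ 3, ∀ s, |E v j s| ≤ C) {v₀ : E3} (hv₀ : ‖v₀‖ = 1) {a : ℝ}
    (ha : etaDeriv v₀ 0 a ≠ 0) :
    ∀ᶠ x : (ℝ × ℝ) × E3 in 𝓝 ((0, 0), v₀), ‖x.2‖ = 1 →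
      FewZeros 5 (pertDeriv E x.1.1 x.2 0) a := by
  by_contra hcon
  obtain ⟨U, hU, hbad⟩ := exists_ultrafilter_of_frequently (not_eventually.1 hcon)
  have hex : ∀ x : (ℝ × ℝ) × E3, ∃ (J : ℤ) (z : Fin 5 → ℝ),
      ¬(‖x.2‖ = 1 → FewZeros 5 (pertDeriv E x.1.1 x.2 0) a) →
      StrictMono z ∧ (∀ l, z l ∈ Icc (a - 2 * Real.pi + J * (2 * Real.pi)) (a + J * (2 * Real.pi)))
        ∧ ∀ l, pertDeriv E x.1.1 x.2 0 (z l) = 0 := by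
    intro x
    by_cases hx : ‖x.2‖ = 1 → FewZeros 5 (pertDeriv E x.1.1 x.2 0) a
    · exact ⟨0, 0, fun h => absurd hx h⟩
    · simp only [FewZeros] at hx
      push Not at hx
      obtain ⟨-, J, z, h⟩ := hx
      exact ⟨J, z, fun _ => h⟩
  choose J z hz using hex
  obtain ⟨τ, -, -, h3, h4, h5, h6, h7⟩ := exists_limit_zeros_pert hE hC (U := U)
    (e := fun x => x.1.1) (V := fun x => x.2) (v₀ := v₀)
    (((by fun_prop : Continuous fun x : (ℝ × ℝ) × E3 => x.1.1).tendsto ((0, 0), v₀)).mono_left hU)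
    (((by fun_prop : Continuous fun x : (ℝ × ℝ) × E3 => x.2).tendsto ((0, 0), v₀)).mono_left hU)
    (hbad.mono fun x hx => (Classical.not_imp.1 hx).1) ha (J := J) (z := z)
    (hbad.mono fun x hx => (hz x hx).1) (hbad.mono fun x hx => (hz x hx).2.1)
    (hbad.mono fun x hx => (hz x hx).2.2)
  exact etaDeriv_zeros_le_four_mult hv₀ (fun i j => abs_sub_lt_of_mem_Ioo (h3 i) (h3 j)) h4 h5 h6 h7

/-- The second real parameter bounds `|v 2|`: letting it tend to zero makes the limit direction
horizontal, where the height is a sinusoid. -/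
lemma eventually_fewZeros_three (hE : ∀ v j s, HasDerivAt (E v j) (E v (j + 1) s) s)
    (hC : ∀ v : E3, ‖v‖ = 1 → ∀ j ≤ 3, ∀ s, |E v j s| ≤ C) {v₀ : E3} (hv₀ : ‖v₀‖ = 1) {a : ℝ}
    (ha : etaDeriv v₀ 0 a ≠ 0) :
    ∀ᶠ x : (ℝ × ℝ) × E3 in 𝓝 ((0, 0), v₀), ‖x.2‖ = 1 → |x.2 2| < |x.1.2| →
      FewZeros 3 (pertDeriv E x.1.1 x.2 0) a := by
  by_contra hcon
  obtain ⟨U, hU, hbad⟩ := exists_ultrafilter_of_frequently (not_eventually.1 hcon)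
  have hex : ∀ x : (ℝ × ℝ) × E3, ∃ (J : ℤ) (z : Fin 3 → ℝ),
      ¬(‖x.2‖ = 1 → |x.2 2| < |x.1.2| → FewZeros 3 (pertDeriv E x.1.1 x.2 0) a) →
      StrictMono z ∧ (∀ l, z l ∈ Icc (a - 2 * Real.pi + J * (2 * Real.pi)) (a + J * (2 * Real.pi)))
        ∧ ∀ l, pertDeriv E x.1.1 x.2 0 (z l) = 0 := by
    intro x
    by_cases hx : ‖x.2‖ = 1 → |x.2 2| < |x.1.2| → FewZeros 3 (pertDeriv E x.1.1 x.2 0) a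
    · exact ⟨0, 0, fun h => absurd hx h⟩
    · simp only [FewZeros] at hx
      push Not at hx
      obtain ⟨-, -, J, z, h⟩ := hx
      exact ⟨J, z, fun _ => h⟩
  choose J z hz using hex
  obtain ⟨τ, -, h2, h3, h4, h5, -, -⟩ := exists_limit_zeros_pert hE hC (U := U)
    (e := fun x => x.1.1) (V := fun x => x.2) (v₀ := v₀)
    (((by fun_prop : Continuous fun x : (ℝ × ℝ) × E3 => x.1.1).tendsto ((0, 0), v₀)).mono_left hU)
    (((by fun_prop : Continuous fun x : (ℝ × ℝ) × E3 => x.2).tendsto ((0, 0), v₀)).mono_left hU)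
    (hbad.mono fun x hx => (Classical.not_imp.1 hx).1) ha (J := J) (z := z)
    (hbad.mono fun x hx => (hz x hx).1) (hbad.mono fun x hx => (hz x hx).2.1)
    (hbad.mono fun x hx => (hz x hx).2.2)
  have hv2 : v₀ 2 = 0 := by
    have t1 : Tendsto (fun x : (ℝ × ℝ) × E3 => |x.2 2|) U (𝓝 |v₀ 2|) :=
      ((by fun_prop : Continuous fun x : (ℝ × ℝ) × E3 => |x.2 2|).tendsto ((0, 0), v₀)).mono_left hU
    have t2 : Tendsto (fun x : (ℝ × ℝ) × E3 => |x.1.2|) U (𝓝 |0|) :=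
      ((by fun_prop : Continuous fun x : (ℝ × ℝ) × E3 => |x.1.2|).tendsto ((0, 0), v₀)).mono_left hU
    have := le_of_tendsto_of_tendsto t1 t2
      (hbad.mono fun x hx => (Classical.not_imp.1 (Classical.not_imp.1 hx).2).1.le)
    rw [abs_zero] at this
    exact abs_eq_zero.1 (le_antisymm this (abs_nonneg _))
  exact sinusoid_zeros_le_two hv₀ hv2 h2 (fun i j => abs_sub_lt_of_mem_Ioo (h3 i) (h3 j)) h4 h5

/-- The heart of (b). The four zeros converge to zeros of the unperturbed derivative. Those with
`|τ| < 3π/4` need no correction because `E` vanishes there; the others are simple and persist. Using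
the actual zeros in the first region keeps them distinct even when their limits collide. -/
lemma eventually_inheritsZeros (hE : ∀ v j s, HasDerivAt (E v j) (E v (j + 1) s) s)
    (hC : ∀ v : E3, ‖v‖ = 1 → ∀ j ≤ 3, ∀ s, |E v j s| ≤ C)
    (hE0 : ∀ v s, |s| < 3 * Real.pi / 4 → E v 0 s = 0) {v₀ : E3} (hv₀ : ‖v₀‖ = 1) {a : ℝ}
    (ha : etaDeriv v₀ 0 a ≠ 0) (haI : a ∈ Ioo (3 * Real.pi / 4) (5 * Real.pi / 4)) :
    ∀ᶠ x : (ℝ × ℝ) × E3 in 𝓝 ((0, 0), v₀), ‖x.2‖ = 1 → x.2 0 < 0 → 0 < x.2 2 →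
      InheritsZeros (pertDeriv E x.1.1 x.2 0) (etaDeriv x.2 0) a := by
  by_contra hcon
  obtain ⟨U, hU, hbad⟩ := exists_ultrafilter_of_frequently (not_eventually.1 hcon)
  have hex : ∀ x : (ℝ × ℝ) × E3, ∃ z : Fin 4 → ℝ,
      ¬(‖x.2‖ = 1 → x.2 0 < 0 → 0 < x.2 2 →
        InheritsZeros (pertDeriv E x.1.1 x.2 0) (etaDeriv x.2 0) a) →
      StrictMono z ∧ (∀ l, z l ∈ Icc (a - 2 * Real.pi) a)
        ∧ (∀ l, pertDeriv E x.1.1 x.2 0 (z l) = 0) ∧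
        ∀ u : Fin 4 → ℝ, Function.Injective u → (∀ l, u l ∈ Ioo (a - 2 * Real.pi) a) →
          ¬ ∀ l, etaDeriv x.2 0 (u l) = 0 := by
    intro x
    by_cases hx : ‖x.2‖ = 1 → x.2 0 < 0 → 0 < x.2 2 →
        InheritsZeros (pertDeriv E x.1.1 x.2 0) (etaDeriv x.2 0) a
    · exact ⟨0, fun h => absurd hx h⟩
    · simp only [InheritsZeros] at hx
      push Not at hx
      obtain ⟨-, -, -, z, h1, h2, h3, h4⟩ := hx
      refine ⟨z, fun _ => ⟨h1, h2, h3, fun u p q r => ?_⟩⟩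
      obtain ⟨l, hl⟩ := h4 u p q
      exact hl (r l)
  choose z hz using hex
  have tV := ((by fun_prop : Continuous fun x : (ℝ × ℝ) × E3 => x.2).tendsto ((0, 0), v₀)).mono_left
    hU
  obtain ⟨τ, h1, h2, h3, h4, h5, -, -⟩ := exists_limit_zeros_pert hE hC (U := U)
    (e := fun x => x.1.1) (V := fun x => x.2) (v₀ := v₀)
    (((by fun_prop : Continuous fun x : (ℝ × ℝ) × E3 => x.1.1).tendsto ((0, 0), v₀)).mono_left hU)
    tV (hbad.mono fun x hx => (Classical.not_imp.1 hx).1) ha (J := fun _ => 0) (z := z)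
    (hbad.mono fun x hx => (hz x hx).1)
    (hbad.mono fun x hx => by simpa using (hz x hx).2.1)
    (hbad.mono fun x hx => (hz x hx).2.2.1)
  simp only [Int.cast_zero, zero_mul, sub_zero] at h1
  have hneg : v₀ 0 ≤ 0 := by
    have t1 : Tendsto (fun x : (ℝ × ℝ) × E3 => x.2 0) U (𝓝 (v₀ 0)) :=
      ((by fun_prop : Continuous fun x : (ℝ × ℝ) × E3 => x.2 0).tendsto ((0, 0), v₀)).mono_left hU
    exact le_of_tendsto t1 (hbad.mono fun x hx =>
      (Classical.not_imp.1 (Classical.not_imp.1 hx).2).1.le)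
  have hpos : 0 ≤ v₀ 2 := by
    have t1 : Tendsto (fun x : (ℝ × ℝ) × E3 => x.2 2) U (𝓝 (v₀ 2)) :=
      ((by fun_prop : Continuous fun x : (ℝ × ℝ) × E3 => x.2 2).tendsto ((0, 0), v₀)).mono_left hU
    exact ge_of_tendsto t1 (hbad.mono fun x hx =>
      (Classical.not_imp.1 (Classical.not_imp.1 (Classical.not_imp.1 hx).2).2).1.le)
  -- A degenerate zero would force `cos (τ l) ≥ 0` by the astroid equation and the signs of `v₀`,
  -- whereas `3π/4 ≤ |τ l| < 5π/4`.
  have hsimple : ∀ l, ¬ |τ l| < 3 * Real.pi / 4 → etaDeriv v₀ 1 (τ l) ≠ 0 := by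
    intro l hl hd
    push Not at hl
    have hne := third_ne_zero_of_astroid hv₀ (h4 l) hd
    have hp : 0 < v₀ 2 := lt_of_le_of_ne hpos hne.symm
    have hc : 0 ≤ Real.cos (τ l) := by
      by_contra hlt
      push Not at hlt
      have h3 : Real.cos (τ l) ^ 3 < 0 := Odd.pow_neg (by decide) hlt
      have := (eq_astroid (h4 l) hd).1
      nlinarith
    have hneg : Real.cos (τ l) < 0 := by
      rw [← Real.cos_abs]
      refine Real.cos_neg_of_pi_div_two_lt_of_lt (by linarith [Real.pi_pos]) ?_
      rw [abs_lt]
      constructor <;> linarith [(h3 l).1, (h3 l).2, haI.1, haI.2, Real.pi_pos]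
    linarith
  have hu : ∀ l, ∃ u : (ℝ × ℝ) × E3 → ℝ, Tendsto u U (𝓝 (τ l)) ∧
      (∀ᶠ x in (U : Filter ((ℝ × ℝ) × E3)), etaDeriv x.2 0 (u x) = 0) ∧
      (|τ l| < 3 * Real.pi / 4 → ∀ x, u x = z x l) := by
    intro l
    by_cases hl : |τ l| < 3 * Real.pi / 4
    · refine ⟨fun x => z x l, h1 l, ?_, fun _ _ => rfl⟩
      filter_upwards [hbad, (h1 l).abs.eventually (gt_mem_nhds hl)] with x hx hlt
      have := (hz x hx).2.2.1 l
      rwa [pertDeriv, hE0 _ _ hlt, mul_zero, add_zero] at this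
    · obtain ⟨u, p, q⟩ := exists_tendsto_zero_of_simple tV (h4 l) (hsimple l hl)
      exact ⟨u, p, q, fun h => absurd h hl⟩
  choose u ut u0 uz using hu
  -- Equal limits are multiple zeros, hence lie in the region where `u` is the original zero `z`.
  have hinj : ∀ k l, k < l → ∀ᶠ x in (U : Filter ((ℝ × ℝ) × E3)), u k x ≠ u l x := by
    intro k l hkl
    by_cases he : τ k = τ l
    · have hk : |τ k| < 3 * Real.pi / 4 := by
        by_contra hk
        exact hsimple k hk (h5 k l hkl he)
      filter_upwards [hbad] with x hx
      rw [uz k hk, uz l (he ▸ hk)]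
      exact ((hz x hx).1 hkl).ne
    · exact (((ut k).sub (ut l)).eventually_ne (sub_ne_zero.2 he)).mono fun x hx => sub_ne_zero.1 hx
  have hinj' : ∀ᶠ x in (U : Filter ((ℝ × ℝ) × E3)), ∀ k l, k < l → u k x ≠ u l x := by
    simp only [eventually_all]
    exact hinj
  have hmem : ∀ᶠ x in (U : Filter ((ℝ × ℝ) × E3)), ∀ l, u l x ∈ Ioo (a - 2 * Real.pi) a :=
    eventually_all.2 fun l => (ut l).eventually (isOpen_Ioo.mem_nhds (h3 l))
  have hzero : ∀ᶠ x in (U : Filter ((ℝ × ℝ) × E3)), ∀ l, etaDeriv x.2 0 (u l x) = 0 :=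
    eventually_all.2 u0
  obtain ⟨x, hx, p, q, r⟩ := (hbad.and (hinj'.and (hmem.and hzero))).exists
  refine (hz x hx).2.2.2 (fun l => u l x) ?_ q r
  intro k l hkl
  by_contra hne
  rcases lt_or_gt_of_ne hne with h | h
  · exact p k l h hkl
  · exact p l k h hkl.symm

/-- Uniform control of the critical points of the height functions of small perturbations. -/
theorem exists_uniform_zero_bounds (hE : ∀ v j s, HasDerivAt (E v j) (E v (j + 1) s) s)
    (hC : ∀ v : E3, ‖v‖ = 1 → ∀ j ≤ 3, ∀ s, |E v j s| ≤ C)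
    (hE0 : ∀ v s, |s| < 3 * Real.pi / 4 → E v 0 s = 0) :
    ∃ r > 0, ∀ ε, |ε| < r → ∀ v : E3, ‖v‖ = 1 →
      ∃ a, FewZeros 5 (pertDeriv E ε v 0) a ∧
        (v 0 < 0 → 0 < v 2 → InheritsZeros (pertDeriv E ε v 0) (etaDeriv v 0) a) ∧
        (|v 2| < r → FewZeros 3 (pertDeriv E ε v 0) a) := by
  -- The cut `a` depends on the limit direction; the tube lemma needs only that some `a` exists for
  -- each `v`. The auxiliary real becomes the bound on `|v 2|` and is finally set to `r / 2`.
  have key := (isCompact_sphere (0 : E3) 1).eventually_forall_of_forall_eventually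
    (x₀ := ((0, 0) : ℝ × ℝ)) (P := fun x v => ‖v‖ = 1 → ∃ a,
      FewZeros 5 (pertDeriv E x.1 v 0) a ∧
        (v 0 < 0 → 0 < v 2 → InheritsZeros (pertDeriv E x.1 v 0) (etaDeriv v 0) a) ∧
        (|v 2| < |x.2| → FewZeros 3 (pertDeriv E x.1 v 0) a)) (by
      intro v₀ hv₀
      rw [mem_sphere_zero_iff_norm] at hv₀
      obtain ⟨a, haI, ha⟩ := exists_regular_cut hv₀
      filter_upwards [eventually_fewZeros_five hE hC hv₀ ha,
        eventually_inheritsZeros hE hC hE0 hv₀ ha haI,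
        eventually_fewZeros_three hE hC hv₀ ha] with x h1 h2 h3 hx
      exact ⟨a, h1 hx, h2 hx, h3 hx⟩)
  obtain ⟨r, hr, hball⟩ := Metric.eventually_nhds_iff.1 key
  refine ⟨r / 2, by positivity, fun ε hε v hv => ?_⟩
  have := @hball (ε, r / 2) (by
    rw [Prod.dist_eq, max_lt_iff]
    simp only [Real.dist_eq, sub_zero]
    exact ⟨by linarith, by rw [abs_of_pos (by positivity)]; linarith⟩) v
    (by rwa [mem_sphere_zero_iff_norm]) hv
  simpa [abs_of_pos (show 0 < r / 2 by positivity)] using this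

end Local

end Superbridge

/-! ### Counting maxima by critical points -/

namespace Superbridge

open Filter Topology Set

section RealFunctions

variable {f H : ℝ → ℝ}

/-- A minimum over the closed interval may be at an endpoint, but a local maximum there has interior
points nearby that are no higher, hence also minimal. -/
lemma exists_zero_between_localMax (hf : ∀ s, HasDerivAt f (H s) s) {p q : ℝ} (hpq : p < q)
    (hp : IsLocalMax f p) (hq : IsLocalMax f q) : ∃ x ∈ Ioo p q, H x = 0 := by
  have hc : Continuous f := continuous_iff_continuousAt.2 fun s => (hf s).continuousAt
  obtain ⟨c, hcm, hmin⟩ := isCompact_Icc.exists_isMinOn (nonempty_Icc.2 hpq.le) hc.continuousOn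
  rw [isMinOn_iff] at hmin
  obtain ⟨x, hx, hxmin⟩ : ∃ x ∈ Ioo p q, ∀ y ∈ Icc p q, f x ≤ f y := by
    rcases eq_or_lt_of_le hcm.1 with rfl | h1
    · obtain ⟨x, hx, hx'⟩ := ((hp.filter_mono nhdsWithin_le_nhds).and
        (Ioo_mem_nhdsGT hpq)).exists
      exact ⟨x, hx', fun y hy => hx.trans (hmin y hy)⟩
    rcases eq_or_lt_of_le hcm.2 with rfl | h2
    · obtain ⟨x, hx, hx'⟩ := ((hq.filter_mono nhdsWithin_le_nhds).and
        (Ioo_mem_nhdsLT hpq)).exists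
      exact ⟨x, hx', fun y hy => hx.trans (hmin y hy)⟩
    exact ⟨c, ⟨h1, h2⟩, hmin⟩
  refine ⟨x, hx, IsLocalMin.hasDerivAt_eq_zero ?_ (hf x)⟩
  filter_upwards [Icc_mem_nhds hx.1 hx.2] with y hy using hxmin y hy

lemma eventually_sign_of_hasDerivAt_pos {c : ℝ} {d : ℝ} (hf : HasDerivAt f d c) (hd : 0 < d) :
    (∀ᶠ x in 𝓝[>] c, f c < f x) ∧ ∀ᶠ x in 𝓝[<] c, f x < f c := by
  have hg : HasDerivAt (fun x => f x - f c) d c := hf.sub_const _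
  have key := eventually_nhdsWithin_sign_eq_of_deriv_pos (f := fun x => f x - f c) (x₀ := c)
    (by rw [hg.deriv]; exact hd) (sub_self _)
  constructor
  · filter_upwards [key.filter_mono nhdsWithin_le_nhds, self_mem_nhdsWithin] with x hx hgt
    rw [sign_pos (sub_pos.2 (show c < x from hgt)), sign_eq_one_iff] at hx
    exact sub_pos.1 hx
  · filter_upwards [key.filter_mono nhdsWithin_le_nhds, self_mem_nhdsWithin] with x hx hlt
    rw [sign_neg (sub_neg.2 (show x < c from hlt)), sign_eq_neg_one_iff] at hx
    exact sub_neg.1 hx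

lemma exists_localMax_of_sign (hf : ∀ s, HasDerivAt f (H s) s) {a b : ℝ} (hab : a < b)
    (ha : 0 < H a) (hb : H b < 0) : ∃ x ∈ Ioo a b, IsLocalMax f x := by
  have hc : Continuous f := continuous_iff_continuousAt.2 fun s => (hf s).continuousAt
  obtain ⟨c, hcm, hmax⟩ := isCompact_Icc.exists_isMaxOn (nonempty_Icc.2 hab.le) hc.continuousOn
  rw [isMaxOn_iff] at hmax
  have h1 : a < c := by
    refine lt_of_le_of_ne hcm.1 ?_
    rintro rfl
    obtain ⟨x, hx, hx'⟩ := ((eventually_sign_of_hasDerivAt_pos (hf a) ha).1.and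
      (Ioo_mem_nhdsGT hab)).exists
    exact absurd (hmax x (Ioo_subset_Icc_self hx')) (not_le.2 hx)
  have h2 : c < b := by
    refine lt_of_le_of_ne hcm.2 ?_
    rintro rfl
    obtain ⟨x, hx, hx'⟩ := ((eventually_sign_of_hasDerivAt_pos (f := fun x => -f x) (hf c).neg
      (neg_pos.2 hb)).2.and (Ioo_mem_nhdsLT hab)).exists
    exact absurd (hmax x (Ioo_subset_Icc_self hx')) (not_le.2 (neg_lt_neg_iff.1 hx))
  refine ⟨c, ⟨h1, h2⟩, ?_⟩
  filter_upwards [Icc_mem_nhds h1 h2] with y hy using hmax y hy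

lemma toIcoMod_injOn_of_abs_lt {L : ℝ} (hL : 0 < L) (b : ℝ) {x y : ℝ} (hd : |x - y| < L)
    (h : toIcoMod hL b x = toIcoMod hL b y) : x = y := by
  obtain ⟨k, hk⟩ := (toIcoMod_eq_toIcoMod hL).1 h
  rw [zsmul_eq_mul] at hk
  have hk0 : |(k : ℝ)| < 1 := by
    have : |(k : ℝ)| * L < 1 * L := by
      rw [one_mul, ← abs_of_pos hL, ← abs_mul, abs_of_pos hL, ← hk, abs_sub_comm]
      exact hd
    exact lt_of_mul_lt_mul_right this hL.le
  have : k = 0 := by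
    rw [← Int.abs_lt_one_iff]; exact_mod_cast hk0
  rw [this] at hk
  norm_num at hk
  linarith

/-- Between cyclically consecutive local maxima of a periodic function there are further critical
points. -/
lemma exists_finset_zeros {L : ℝ} (hL : 0 < L) (hf : ∀ s, HasDerivAt f (H s) s)
    (hfp : Function.Periodic f L) (hHp : Function.Periodic H L) {N : ℕ} (hN : 0 < N) {b : ℝ}
    {p : Fin N → ℝ} (hp : StrictMono p) (hpm : ∀ i, p i ∈ Ico b (b + L))
    (hmax : ∀ i, IsLocalMax f (p i)) (b' : ℝ) :
    ∃ S : Finset ℝ, S.card = 2 * N ∧ ∀ s ∈ S, s ∈ Ico b' (b' + L) ∧ H s = 0 := by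
  classical
  -- The cyclic successor: after the last maximum comes the first one, a period later.
  let p' : Fin N → ℝ := fun i => if h : (i : ℕ) + 1 < N then p ⟨i + 1, h⟩ else p ⟨0, hN⟩ + L
  have hlast : IsLocalMax f (p ⟨0, hN⟩ + L) := by
    have h1 : Tendsto (fun x => x - L) (𝓝 (p ⟨0, hN⟩ + L)) (𝓝 (p ⟨0, hN⟩)) :=
      (by fun_prop : Continuous fun x : ℝ => x - L).tendsto' _ _ (by ring)
    have := h1.eventually (hmax ⟨0, hN⟩)
    filter_upwards [this] with x hx
    rw [hfp]
    rwa [hfp.sub_eq] at hx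
  have hp0 : ∀ i, p ⟨0, hN⟩ ≤ p i := fun i => hp.monotone (Fin.mk_le_of_le_val (Nat.zero_le _))
  have hq : ∀ i, ∃ q ∈ Ioo (p i) (p' i), H q = 0 := by
    intro i
    simp only [p']
    split_ifs with h
    · exact exists_zero_between_localMax hf (hp (Fin.mk_lt_mk.2 (Nat.lt_succ_self _))) (hmax _)
        (hmax _)
    · refine exists_zero_between_localMax hf ?_ (hmax _) hlast
      linarith [(hpm i).2, (hpm ⟨0, hN⟩).1]
  choose q hq hq0 using hq
  have hqL : ∀ i, q i < p ⟨0, hN⟩ + L := by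
    intro i
    refine (hq i).2.trans_le ?_
    simp only [p']
    split_ifs with h
    · linarith [(hpm ⟨i + 1, h⟩).2, (hpm ⟨0, hN⟩).1]
    · exact le_rfl
  have hqp : ∀ i j, i < j → q i < p j := by
    intro i j hij
    have h : (i : ℕ) + 1 < N := lt_of_le_of_lt (Nat.succ_le_of_lt hij) j.2
    refine (hq i).2.trans_le ?_
    simp only [p', h, dif_pos]
    exact hp.monotone (Nat.succ_le_of_lt hij)
  let W : Fin N ⊕ Fin N → ℝ := Sum.elim p q
  have hWm : ∀ x, W x ∈ Ico (p ⟨0, hN⟩) (p ⟨0, hN⟩ + L) := by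
    rintro (i | i)
    · exact ⟨hp0 i, by simp only [W, Sum.elim_inl]; linarith [(hpm i).2, (hpm ⟨0, hN⟩).1]⟩
    · exact ⟨(hp0 i).trans (hq i).1.le, hqL i⟩
  have hWinj : Function.Injective W := by
    have hne : ∀ i j, p i ≠ q j := by
      intro i j
      rcases lt_or_ge j i with h | h
      · exact (hqp j i h).ne'
      · exact ((hp.monotone h).trans_lt (hq j).1).ne
    refine Function.Injective.sumElim hp.injective ?_ hne
    refine StrictMono.injective fun i j hij => ?_
    exact (hqp i j hij).trans (hq j).1
  have hW0 : ∀ x, H (W x) = 0 := by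
    rintro (i | i)
    · exact (hmax i).hasDerivAt_eq_zero (hf _)
    · exact hq0 i
  -- The points lie in one half-open period, so reduction to the window at `b'` keeps them distinct.
  refine ⟨Finset.univ.image fun x => toIcoMod hL b' (W x), ?_, ?_⟩
  · rw [Finset.card_image_of_injective]
    · simp; ring
    · intro x y hxy
      refine hWinj (toIcoMod_injOn_of_abs_lt hL b' ?_ hxy)
      have a := hWm x
      have b := hWm y
      rw [abs_lt]
      constructor <;> linarith [a.1, a.2, b.1, b.2]
  · intro s hs
    obtain ⟨x, -, rfl⟩ := Finset.mem_image.1 hs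
    refine ⟨toIcoMod_mem_Ico hL b' _, ?_⟩
    rw [toIcoMod, hHp.sub_zsmul_eq]
    exact hW0 x

/-- The index of the turn that contains a parameter. -/
lemma turn_mem {a s : ℝ} {n : ℕ} (hs : s ∈ Ico (a - 2 * Real.pi) (a - 2 * Real.pi + n * (2 * Real.pi))) :
    ⌊(s - (a - 2 * Real.pi)) / (2 * Real.pi)⌋₊ ∈ Finset.range n := by
  rw [Finset.mem_range, Nat.floor_lt (div_nonneg (sub_nonneg.2 hs.1) Real.two_pi_pos.le),
    div_lt_iff₀ Real.two_pi_pos]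
  linarith [hs.2]

lemma mem_of_turn_eq {a s : ℝ} {j : ℕ} (hs : a - 2 * Real.pi ≤ s)
    (h : ⌊(s - (a - 2 * Real.pi)) / (2 * Real.pi)⌋₊ = j) :
    s ∈ Icc (a - 2 * Real.pi + (j : ℤ) * (2 * Real.pi)) (a + (j : ℤ) * (2 * Real.pi)) := by
  rw [Nat.floor_eq_iff (div_nonneg (sub_nonneg.2 hs) Real.two_pi_pos.le),
    le_div_iff₀ Real.two_pi_pos, div_lt_iff₀ Real.two_pi_pos] at h
  push_cast
  constructor <;> linarith [h.1, h.2]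

lemma card_turn_le {m n : ℕ} {a : ℝ} (hH : FewZeros (m + 1) H a) {S : Finset ℝ}
    (hS : ∀ s ∈ S, s ∈ Ico (a - 2 * Real.pi) (a - 2 * Real.pi + n * (2 * Real.pi)) ∧ H s = 0)
    (j : ℕ) :
    (S.filter fun s => ⌊(s - (a - 2 * Real.pi)) / (2 * Real.pi)⌋₊ = j).card ≤ m := by
  by_contra! hlt
  set T := S.filter fun s => ⌊(s - (a - 2 * Real.pi)) / (2 * Real.pi)⌋₊ = j
  have hT : ∀ i, T.orderEmbOfCardLe hlt i ∈ T := fun i => T.orderEmbOfCardLe_mem hlt i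
  refine hH j (T.orderEmbOfCardLe hlt) (OrderEmbedding.strictMono _) (fun i => ?_) fun i => ?_
  · have := Finset.mem_filter.1 (hT i)
    exact mem_of_turn_eq (hS _ this.1).1.1 this.2
  · exact (hS _ (Finset.mem_filter.1 (hT i)).1).2

lemma card_le_of_fewZeros {m n : ℕ} {a : ℝ} (hH : FewZeros (m + 1) H a) {S : Finset ℝ}
    (hS : ∀ s ∈ S, s ∈ Ico (a - 2 * Real.pi) (a - 2 * Real.pi + n * (2 * Real.pi)) ∧ H s = 0) :
    S.card ≤ m * n := by
  have := Finset.card_le_mul_card_image_of_maps_to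
    (f := fun s => ⌊(s - (a - 2 * Real.pi)) / (2 * Real.pi)⌋₊) (s := S) (t := Finset.range n)
    (fun s hs => turn_mem (hS s hs).1) m (fun j _ => card_turn_le hH hS j)
  simpa using this

/-- If the number of critical points is the largest possible, then the first turn contains four. -/
lemma exists_four_zeros {n : ℕ} (hn : 0 < n) {a : ℝ} (hH : FewZeros 5 H a) {S : Finset ℝ}
    (hS : ∀ s ∈ S, s ∈ Ico (a - 2 * Real.pi) (a - 2 * Real.pi + n * (2 * Real.pi)) ∧ H s = 0)
    (hcard : 4 * n ≤ S.card) :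
    ∃ z : Fin 4 → ℝ, StrictMono z ∧ (∀ l, z l ∈ Icc (a - 2 * Real.pi) a) ∧ ∀ l, H (z l) = 0 := by
  classical
  set F : ℝ → ℕ := fun s => ⌊(s - (a - 2 * Real.pi)) / (2 * Real.pi)⌋₊ with hF
  -- The other `n - 1` turns hold at most `4 (n - 1)` of the points, leaving four for turn `0`.
  have h1 := Finset.card_le_mul_card_image_of_maps_to (f := F) (s := S.filter fun s => ¬ F s = 0)
    (t := (Finset.range n).erase 0)
    (fun s hs => Finset.mem_erase.2 ⟨(Finset.mem_filter.1 hs).2,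
      turn_mem (hS s (Finset.mem_filter.1 hs).1).1⟩) 4 (fun j _ =>
      (Finset.card_le_card (Finset.filter_subset_filter _ (Finset.filter_subset _ _))).trans
        (card_turn_le hH hS j))
  rw [Finset.card_erase_of_mem (Finset.mem_range.2 hn), Finset.card_range] at h1
  have h2 := Finset.card_filter_add_card_filter_not (s := S) (fun s => F s = 0)
  have h4 : 4 ≤ (S.filter fun s => F s = 0).card := by omega
  set T := S.filter fun s => F s = 0
  have hT : ∀ i, T.orderEmbOfCardLe h4 i ∈ T := fun i => T.orderEmbOfCardLe_mem h4 i
  refine ⟨T.orderEmbOfCardLe h4, OrderEmbedding.strictMono _, fun i => ?_, fun i => ?_⟩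
  · have := Finset.mem_filter.1 (hT i)
    simpa using mem_of_turn_eq (hS _ this.1).1.1 this.2
  · exact (hS _ (Finset.mem_filter.1 (hT i)).1).2

end RealFunctions

/-! ### Simple closed curves and crookedness -/

/-- `γ` is a simple closed curve of period `L`. -/
structure IsSimpleClosed (γ : ℝ → E3) (L : ℝ) : Prop where
  pos : 0 < L
  continuous : Continuous γ
  periodic : Function.Periodic γ L
  injective_mod : ∀ s t, γ s = γ t → ∃ k : ℤ, t = s + k * L

namespace IsSimpleClosed

variable {γ : ℝ → E3} {L : ℝ}

lemma eq_of_abs_sub_lt (hγ : IsSimpleClosed γ L) {s t : ℝ} (h : γ s = γ t) (hd : |s - t| < L) :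
    s = t := by
  obtain ⟨k, hk⟩ := hγ.injective_mod s t h
  refine toIcoMod_injOn_of_abs_lt hγ.pos 0 hd ((toIcoMod_eq_toIcoMod hγ.pos).2 ⟨k, ?_⟩)
  rw [zsmul_eq_mul, hk]; ring

/-- The arc away from `s` has compact image missing `γ s`, so points of the curve near `γ s` have
parameters near `s` modulo the period. -/
lemma isLocalMaxOn_iff (hγ : IsSimpleClosed γ L) (v : E3) (s : ℝ) :
    IsLocalMaxOn (fun q : E3 => inner ℝ v q) (range γ) (γ s) ↔
      IsLocalMax (fun t => inner ℝ v (γ t)) s := by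
  constructor
  · intro h
    have ht : Tendsto γ (𝓝 s) (𝓝[range γ] (γ s)) :=
      tendsto_nhdsWithin_iff.2 ⟨hγ.continuous.tendsto s, Eventually.of_forall fun t => ⟨t, rfl⟩⟩
    exact ht.eventually h
  · intro h
    obtain ⟨r, hr, hball⟩ := Metric.eventually_nhds_iff.1 h
    let r' := min r (L / 2)
    have hr' : 0 < r' := lt_min hr (half_pos hγ.pos)
    have hr1 : r' ≤ r := min_le_left _ _
    have hr2 : r' ≤ L / 2 := min_le_right _ _
    have hcl : IsClosed (γ '' Icc (s + r') (s + L - r')) :=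
      (isCompact_Icc.image hγ.continuous).isClosed
    have hnot : γ s ∉ γ '' Icc (s + r') (s + L - r') := by
      rintro ⟨t, ht, he⟩
      have : t = s := hγ.eq_of_abs_sub_lt he (by
        rw [abs_lt]; constructor <;> linarith [ht.1, ht.2, hγ.pos])
      linarith [ht.1]
    filter_upwards [nhdsWithin_le_nhds (hcl.isOpen_compl.mem_nhds hnot), self_mem_nhdsWithin]
      with q hq hqr
    obtain ⟨t, rfl⟩ := hqr
    set u := toIcoMod hγ.pos (s - r') t with hu
    have hum : u ∈ Ico (s - r') (s - r' + L) := toIcoMod_mem_Ico hγ.pos _ _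
    have hut : γ u = γ t := by rw [hu, toIcoMod, hγ.periodic.sub_zsmul_eq]
    rw [← hut] at hq ⊢
    have hult : u < s + r' := by
      by_contra! hge
      exact hq ⟨u, ⟨hge, by linarith [hum.2]⟩, rfl⟩
    rcases eq_or_lt_of_le hum.1 with he | hlt
    · exfalso
      refine hq ⟨s - r' + L, ⟨by linarith, by linarith⟩, ?_⟩
      rw [hγ.periodic, he]
    · refine hball (lt_of_lt_of_le ?_ hr1)
      rw [Real.dist_eq, abs_lt]
      constructor <;> linarith

lemma le_encard_localMaxPoints (hγ : IsSimpleClosed γ L) (v : E3) {N : ℕ} {b : ℝ} {p : Fin N → ℝ}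
    (hp : Function.Injective p) (hpm : ∀ i, p i ∈ Ico b (b + L))
    (hmax : ∀ i, IsLocalMax (fun t => inner ℝ v (γ t)) (p i)) :
    (N : ℕ∞) ≤ (localMaxPoints (range γ) v).encard := by
  have hinj : Function.Injective fun i => γ (p i) := by
    intro i j hij
    refine hp (hγ.eq_of_abs_sub_lt hij ?_)
    have a := hpm i
    have c := hpm j
    rw [abs_lt]
    constructor <;> linarith [a.1, a.2, c.1, c.2]
  have hsub : range (fun i => γ (p i)) ⊆ localMaxPoints (range γ) v := by
    rintro _ ⟨i, rfl⟩
    exact ⟨⟨p i, rfl⟩, (hγ.isLocalMaxOn_iff v _).2 (hmax i)⟩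
  calc (N : ℕ∞) = (range fun i => γ (p i)).encard := by
        rw [← image_univ, hinj.encard_image, encard_univ]; simp
    _ ≤ _ := encard_le_encard hsub

lemma exists_params_of_le_encard (hγ : IsSimpleClosed γ L) (v : E3) {N : ℕ} (b : ℝ)
    (hN : (N : ℕ∞) ≤ (localMaxPoints (range γ) v).encard) :
    ∃ p : Fin N → ℝ, StrictMono p ∧ (∀ i, p i ∈ Ico b (b + L)) ∧
      ∀ i, IsLocalMax (fun t => inner ℝ v (γ t)) (p i) := by
  classical
  obtain ⟨T, hT, hcard⟩ := exists_subset_encard_eq hN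
  have hex : ∀ q : E3, ∃ s : ℝ, q ∈ T →
      (s ∈ Ico b (b + L) ∧ γ s = q ∧ IsLocalMax (fun t => inner ℝ v (γ t)) s) := by
    intro q
    by_cases hq : q ∈ T
    · obtain ⟨⟨t, rfl⟩, hm⟩ := hT hq
      have e : γ (toIcoMod hγ.pos b t) = γ t := by rw [toIcoMod, hγ.periodic.sub_zsmul_eq]
      refine ⟨toIcoMod hγ.pos b t, fun _ => ⟨toIcoMod_mem_Ico hγ.pos _ _, e, ?_⟩⟩
      rw [← hγ.isLocalMaxOn_iff, e]
      exact hm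
    · exact ⟨0, fun h => absurd h hq⟩
  choose σ hσ using hex
  have hfin : T.Finite := by
    rw [← encard_lt_top_iff, hcard]; exact ENat.natCast_lt_top N
  let S := hfin.toFinset.image σ
  have hSc : S.card = N := by
    rw [Finset.card_image_of_injOn]
    · have := hfin.encard_eq_coe_toFinset_card
      rw [hcard] at this
      exact_mod_cast this.symm
    · intro x hx y hy hxy
      have hx' := hσ x (by simpa using hx)
      have hy' := hσ y (by simpa using hy)
      rw [← hx'.2.1, ← hy'.2.1, hxy]
  have hS : ∀ s ∈ S, s ∈ Ico b (b + L) ∧ IsLocalMax (fun t => inner ℝ v (γ t)) s := by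
    intro s hs
    obtain ⟨q, hq, rfl⟩ := Finset.mem_image.1 hs
    have := hσ q (by simpa using hq)
    exact ⟨this.1, this.2.2⟩
  refine ⟨S.orderEmbOfFin hSc, OrderEmbedding.strictMono _, fun i => ?_, fun i => ?_⟩
  · exact (hS _ (S.orderEmbOfFin_mem hSc i)).1
  · exact (hS _ (S.orderEmbOfFin_mem hSc i)).2

end IsSimpleClosed

lemma crookedness_le_encard (v : E3) (K : Set E3) :
    crookedness v K ≤ (localMaxPoints K v).encard :=
  ENat.card_le_card_of_injective
    (Function.injective_surjInv (ConnectedComponents.surjective_coe (α := localMaxPoints K v)))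

/-- A finite subset of a Hausdorff space is discrete, so its components are points. Thus bounding
the number of maxima also turns crookedness into a cardinality. -/
lemma crookedness_eq_encard {v : E3} {K : Set E3} (h : (localMaxPoints K v).Finite) :
    crookedness v K = (localMaxPoints K v).encard := by
  refine le_antisymm (crookedness_le_encard v K) ?_
  have : Finite (localMaxPoints K v) := h
  refine ENat.card_le_card_of_injective
    (f := ((↑) : localMaxPoints K v → ConnectedComponents (localMaxPoints K v))) ?_
  intro x y hxy
  rw [ConnectedComponents.coe_eq_coe, connectedComponent_eq_singleton,
    connectedComponent_eq_singleton] at hxy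
  exact singleton_injective hxy

namespace IsSimpleClosed

variable {γ : ℝ → E3} {n : ℕ} {v : E3} {H : ℝ → ℝ} {a : ℝ}

/-- If every turn has at most `2m` critical points, then there are at most `mn` local maxima. -/
lemma encard_le (hγ : IsSimpleClosed γ (n * (2 * Real.pi)))
    (hH : ∀ s, HasDerivAt (fun t => inner ℝ v (γ t)) (H s) s)
    (hHp : Function.Periodic H (n * (2 * Real.pi))) {m : ℕ} (hf : FewZeros (2 * m + 1) H a) :
    (localMaxPoints (range γ) v).encard ≤ (m * n : ℕ) := by
  by_contra! hlt
  obtain ⟨p, hp, hpm, hmax⟩ := hγ.exists_params_of_le_encard v 0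
    (show ((m * n + 1 : ℕ) : ℕ∞) ≤ _ by push_cast; exact Order.add_one_le_of_lt (by exact_mod_cast hlt))
  obtain ⟨S, hS, hS'⟩ := exists_finset_zeros hγ.pos hH (fun t => by simp only [hγ.periodic t]) hHp
    (Nat.succ_pos _) hp hpm hmax (a - 2 * Real.pi)
  have := card_le_of_fewZeros hf hS'
  rw [hS] at this
  nlinarith

lemma exists_four_zeros_of_le (hγ : IsSimpleClosed γ (n * (2 * Real.pi))) (hn : 0 < n)
    (hH : ∀ s, HasDerivAt (fun t => inner ℝ v (γ t)) (H s) s)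
    (hHp : Function.Periodic H (n * (2 * Real.pi))) (hf : FewZeros 5 H a)
    (hle : ((2 * n : ℕ) : ℕ∞) ≤ (localMaxPoints (range γ) v).encard) :
    ∃ z : Fin 4 → ℝ, StrictMono z ∧ (∀ l, z l ∈ Icc (a - 2 * Real.pi) a) ∧ ∀ l, H (z l) = 0 := by
  obtain ⟨p, hp, hpm, hmax⟩ := hγ.exists_params_of_le_encard v 0 hle
  obtain ⟨S, hS, hS'⟩ := exists_finset_zeros hγ.pos hH (fun t => by simp only [hγ.periodic t]) hHp
    (by omega) hp hpm hmax (a - 2 * Real.pi)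
  exact exists_four_zeros hn hf hS' (by omega)

/-- Each change of sign from plus to minus traps a maximum; `2 * r ≤ d` makes the traps disjoint and
`N * d ≤ L` fits them into one period. -/
lemma le_encard_of_sign {L : ℝ} (hγ : IsSimpleClosed γ L)
    (hH : ∀ s, HasDerivAt (fun t => inner ℝ v (γ t)) (H s) s) {N : ℕ} {x₀ d r : ℝ} (hr : 0 < r)
    (hrd : 2 * r ≤ d) (hL : N * d ≤ L)
    (hpos : ∀ j : ℕ, 0 < H (x₀ + j * d - r)) (hneg : ∀ j : ℕ, H (x₀ + j * d + r) < 0) :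
    (N : ℕ∞) ≤ (localMaxPoints (range γ) v).encard := by
  have hex : ∀ j : ℕ, ∃ p ∈ Ioo (x₀ + j * d - r) (x₀ + j * d + r),
      IsLocalMax (fun t => inner ℝ v (γ t)) p := fun j =>
    exists_localMax_of_sign hH (by linarith) (hpos j) (hneg j)
  choose p hp hmax using hex
  have hmono : StrictMono p := by
    refine strictMono_nat_of_lt_succ fun j => ?_
    have a := (hp j).2
    have b := (hp (j + 1)).1
    push_cast at b
    linarith
  refine hγ.le_encard_localMaxPoints v (b := x₀ - r) (p := fun j : Fin N => p j)
    (fun i j hij => Fin.ext (hmono.injective hij)) (fun j => ?_) fun j => hmax j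
  have h1 := (hp j).1
  have h2 := (hp j).2
  have h3 : ((j : ℕ) : ℝ) + 1 ≤ N := by exact_mod_cast j.2
  have h0 : (0 : ℝ) ≤ ((j : ℕ) : ℝ) := Nat.cast_nonneg _
  constructor <;> nlinarith

end IsSimpleClosed

end Superbridge

/-! ### The curves `K^ε` -/

namespace Superbridge

open Filter Topology Set

lemma periodic_of_hasDerivAt {f H : ℝ → ℝ} {L : ℝ} (hf : ∀ s, HasDerivAt f (H s) s)
    (hp : Function.Periodic f L) : Function.Periodic H L := by
  intro s
  have h1 : HasDerivAt (fun x => f (x + L)) (H (s + L)) s := (hf (s + L)).comp_add_const s L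
  have h2 : (fun x => f (x + L)) = f := funext hp
  rw [h2] at h1
  exact h1.unique (hf s)

lemma iteratedDeriv_hasDerivAt {f : ℝ → ℝ} (hf : ContDiff ℝ ∞ f) (k : ℕ) (s : ℝ) :
    HasDerivAt (iteratedDeriv k f) (iteratedDeriv (k + 1) f s) s := by
  rw [iteratedDeriv_succ]
  exact ((hf.differentiable_iteratedDeriv k (by exact_mod_cast ENat.natCast_lt_top k)) s).hasDerivAt

lemma iteratedDeriv_periodic {f : ℝ → ℝ} (hf : ContDiff ℝ ∞ f) {L : ℝ} (hp : Function.Periodic f L)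
    (k : ℕ) : Function.Periodic (iteratedDeriv k f) L := by
  induction k with
  | zero => simpa using hp
  | succ k ih => exact periodic_of_hasDerivAt (iteratedDeriv_hasDerivAt hf k) ih

lemma exists_bound_of_periodic {f : ℝ → ℝ} (hf : Continuous f) {L : ℝ} (hL : 0 < L)
    (hp : Function.Periodic f L) : ∃ C, ∀ s, |f s| ≤ C := by
  obtain ⟨C, hC⟩ := (isCompact_Icc (a := (0 : ℝ)) (b := L)).exists_bound_of_continuousOn
    hf.continuousOn
  refine ⟨C, fun s => ?_⟩
  obtain ⟨t, ht, he⟩ := hp.exists_mem_Ico₀ hL s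
  rw [he]
  exact hC t (Ico_subset_Icc_self ht)

lemma exists_bound_iteratedDeriv {f : ℝ → ℝ} (hf : ContDiff ℝ ∞ f) {L : ℝ} (hL : 0 < L)
    (hp : Function.Periodic f L) (m : ℕ) : ∃ C, ∀ k ≤ m, ∀ s, |iteratedDeriv k f s| ≤ C := by
  have hb : ∀ k, ∃ C, ∀ s, |iteratedDeriv k f s| ≤ C := fun k =>
    exists_bound_of_periodic (continuous_iff_continuousAt.2 fun s =>
      (iteratedDeriv_hasDerivAt hf k s).continuousAt) hL (iteratedDeriv_periodic hf hp k)
  choose C hC using hb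
  refine ⟨∑ k ∈ Finset.range (m + 1), C k, fun k hk s => (hC k s).trans ?_⟩
  exact Finset.single_le_sum (f := C) (fun i _ => (abs_nonneg _).trans (hC i 0))
    (Finset.mem_range.2 (Nat.lt_succ_of_le hk))

/-- The derivatives of the height function of the perturbation of `eta` by the radial component `p`
and the vertical component `q`. -/
noncomputable def braidPert (p q : ℝ → ℝ) (v : E3) (j : ℕ) (s : ℝ) : ℝ :=
  v 0 * iteratedDeriv (j + 1) (fun t => p t * Real.cos t) s +
    v 1 * iteratedDeriv (j + 1) (fun t => p t * Real.sin t) s +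
    v 2 * iteratedDeriv (j + 1) q s

lemma abs_coord_le_one {v : E3} (hv : ‖v‖ = 1) (i : Fin 3) : |v i| ≤ 1 := by
  rw [← hv, ← Real.norm_eq_abs]; exact PiLp.norm_apply_le v i

section BraidPert

variable {p q : ℝ → ℝ}

lemma braidPert_hasDerivAt (hp : ContDiff ℝ ∞ p) (hq : ContDiff ℝ ∞ q) (v : E3) (j : ℕ) (s : ℝ) :
    HasDerivAt (braidPert p q v j) (braidPert p q v (j + 1) s) s :=
  (((iteratedDeriv_hasDerivAt (hp.mul Real.contDiff_cos) (j + 1) s).const_mul (v 0)).add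
    ((iteratedDeriv_hasDerivAt (hp.mul Real.contDiff_sin) (j + 1) s).const_mul (v 1))).add
    ((iteratedDeriv_hasDerivAt hq (j + 1) s).const_mul (v 2))

lemma exists_bound_braidPert (hp : ContDiff ℝ ∞ p) (hq : ContDiff ℝ ∞ q) {n : ℕ} (hn : 0 < n)
    (hpp : Function.Periodic p (n * (2 * Real.pi)))
    (hqp : Function.Periodic q (n * (2 * Real.pi))) :
    ∃ C, 0 ≤ C ∧ ∀ v : E3, ‖v‖ = 1 → ∀ j ≤ 3, ∀ s, |braidPert p q v j s| ≤ C := by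
  have hL : 0 < n * (2 * Real.pi) := mul_pos (Nat.cast_pos.2 hn) Real.two_pi_pos
  have hcos : Function.Periodic Real.cos (n * (2 * Real.pi)) := Real.cos_periodic.nat_mul n
  have hsin : Function.Periodic Real.sin (n * (2 * Real.pi)) := Real.sin_periodic.nat_mul n
  obtain ⟨A, hA⟩ := exists_bound_iteratedDeriv (hp.mul Real.contDiff_cos) hL (hpp.mul hcos) 4
  obtain ⟨B, hB⟩ := exists_bound_iteratedDeriv (hp.mul Real.contDiff_sin) hL (hpp.mul hsin) 4
  obtain ⟨D, hD⟩ := exists_bound_iteratedDeriv hq hL hqp 4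
  have hA0 := (abs_nonneg _).trans (hA 0 (by norm_num) 0)
  have hB0 := (abs_nonneg _).trans (hB 0 (by norm_num) 0)
  have hD0 := (abs_nonneg _).trans (hD 0 (by norm_num) 0)
  refine ⟨A + B + D, by positivity, fun v hv j hj s => ?_⟩
  have key : ∀ (i : Fin 3) {x M : ℝ}, |x| ≤ M → |v i * x| ≤ M := fun i x M hx => by
    rw [abs_mul]
    exact (mul_le_of_le_one_left (abs_nonneg x) (abs_coord_le_one hv i)).trans hx
  exact (abs_add_three _ _ _).trans (add_le_add (add_le_add
    (key 0 (hA (j + 1) (by omega) s)) (key 1 (hB (j + 1) (by omega) s)))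
    (key 2 (hD (j + 1) (by omega) s)))

lemma braidPert_eq_zero {r : ℝ} (hp : ∀ s, |s| < r → p s = 0) (hq : ∀ s, |s| < r → q s = 0)
    (v : E3) (s : ℝ) (hs : |s| < r) : braidPert p q v 0 s = 0 := by
  have hU : ∀ᶠ t in 𝓝 s, |t| < r := (continuous_abs.tendsto s).eventually (gt_mem_nhds hs)
  have key : ∀ f : ℝ → ℝ, (∀ t, |t| < r → f t = 0) → deriv f s = 0 := by
    intro f hf
    have : f =ᶠ[𝓝 s] fun _ => 0 := hU.mono fun t ht => hf t ht
    rw [this.deriv_eq, deriv_const]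
  simp only [braidPert, zero_add, iteratedDeriv_one]
  rw [key _ fun t ht => by rw [hp t ht, zero_mul], key _ fun t ht => by rw [hp t ht, zero_mul],
    key _ hq]
  ring

end BraidPert

lemma inner_vec (v : E3) (x y z : ℝ) :
    inner ℝ v !₂[x, y, z] = v 0 * x + v 1 * y + v 2 * z := by
  simp [PiLp.inner_apply, Fin.sum_univ_three, mul_comm]

/-- The curve `braidCurve`, parametrized by the angle around the axis. -/
noncomputable def angleCurve (n : ℕ) (l₁ l₂ : ℝ → ℝ) (ε s : ℝ) : E3 :=
  braidCurve n l₁ l₂ ε (s / n)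

namespace IsBraidData

variable {n : ℕ} {l₁ l₂ : ℝ → ℝ} (h : IsBraidData n l₁ l₂)
include h

lemma cast_pos : (0 : ℝ) < n := Nat.cast_pos.2 h.pos

lemma range_angleCurve (ε : ℝ) : range (angleCurve n l₁ l₂ ε) = braidKnot n l₁ l₂ ε := by
  ext q
  constructor
  · rintro ⟨s, rfl⟩; exact ⟨s / n, rfl⟩
  · rintro ⟨t, rfl⟩
    exact ⟨n * t, by rw [angleCurve, mul_div_cancel_left₀ _ h.cast_pos.ne']⟩

lemma angleCurve_eq (ε s : ℝ) : angleCurve n l₁ l₂ ε s =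
    !₂[(1 + ε * l₁ (s / n)) * Real.cos s, (1 + ε * l₁ (s / n)) * Real.sin s,
      ε * l₂ (s / n) + Real.cos s ^ 2] := by
  rw [angleCurve, braidCurve, mul_div_cancel₀ _ h.cast_pos.ne']

lemma periodic_div {α : Type*} {l : ℝ → α} (hl : Function.Periodic l (2 * Real.pi)) :
    Function.Periodic (fun s => l (s / n)) (n * (2 * Real.pi)) := by
  intro s
  have : (s + n * (2 * Real.pi)) / n = s / n + 2 * Real.pi := by
    field_simp [h.cast_pos.ne']
  simp only [this, hl (s / n)]

lemma one_add_pos {ε : ℝ} (h0 : 0 < ε) (h1 : ε ≤ 1) (t : ℝ) : 0 < 1 + ε * l₁ t := by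
  have := h.in_torus t
  nlinarith [sq_nonneg (l₂ t), sq_nonneg (l₁ t + 1), sq_nonneg (l₁ t - 1)]

/-- The radius is positive, so the first two coordinates determine it and the angle, hence `l₁`; the
third then gives `l₂`. A double point for any `ε` is thus one for `ε = 1`, which makes every `K^ε`
simple. -/
lemma braidCurve_one_eq {ε : ℝ} (h0 : 0 < ε) (h1 : ε ≤ 1) {s t : ℝ}
    (he : braidCurve n l₁ l₂ ε s = braidCurve n l₁ l₂ ε t) :
    braidCurve n l₁ l₂ 1 s = braidCurve n l₁ l₂ 1 t := by
  have ex := congrArg (fun q : E3 => q 0) he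
  have ey := congrArg (fun q : E3 => q 1) he
  have ez := congrArg (fun q : E3 => q 2) he
  simp [braidCurve] at ex ey ez
  have ps := h.one_add_pos h0 h1 s
  have pt := h.one_add_pos h0 h1 t
  have hsq : (1 + ε * l₁ s) ^ 2 = (1 + ε * l₁ t) ^ 2 := by
    have a := Real.sin_sq_add_cos_sq (n * s)
    have b := Real.sin_sq_add_cos_sq (n * t)
    calc (1 + ε * l₁ s) ^ 2 = ((1 + ε * l₁ s) * Real.cos (n * s)) ^ 2 +
          ((1 + ε * l₁ s) * Real.sin (n * s)) ^ 2 := by linear_combination -(1 + ε * l₁ s) ^ 2 * a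
      _ = _ := by rw [ex, ey]; linear_combination (1 + ε * l₁ t) ^ 2 * b
  have hr : 1 + ε * l₁ s = 1 + ε * l₁ t := (pow_left_inj₀ ps.le pt.le two_ne_zero).1 hsq
  have hl : l₁ s = l₁ t := mul_left_cancel₀ h0.ne' (add_left_cancel hr)
  rw [hr] at ex ey
  have hc := mul_left_cancel₀ pt.ne' ex
  have hs := mul_left_cancel₀ pt.ne' ey
  rw [hc] at ez
  have hl2 : l₂ s = l₂ t := mul_left_cancel₀ h0.ne' (add_right_cancel ez)
  simp only [braidCurve, hl, hc, hs, hl2]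

lemma periodic_braidCurve (ε : ℝ) : Function.Periodic (braidCurve n l₁ l₂ ε) (2 * Real.pi) := by
  intro t
  have e : n * (t + 2 * Real.pi) = n * t + n * (2 * Real.pi) := by ring
  simp only [braidCurve, h.periodic₁ t, h.periodic₂ t, e, Real.cos_add_nat_mul_two_pi,
    Real.sin_add_nat_mul_two_pi]

lemma isSimpleClosed {ε : ℝ} (h0 : 0 < ε) (h1 : ε ≤ 1) :
    IsSimpleClosed (angleCurve n l₁ l₂ ε) (n * (2 * Real.pi)) where
  pos := mul_pos h.cast_pos Real.two_pi_pos
  continuous := by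
    have c1 := h.smooth₁.continuous
    have c2 := h.smooth₂.continuous
    rw [funext (h.angleCurve_eq ε)]
    fun_prop
  periodic := h.periodic_div (h.periodic_braidCurve ε)
  injective_mod := by
    intro s t he
    have h1 := h.braidCurve_one_eq h0 h1 he
    have hmod : ∀ x, braidCurve n l₁ l₂ 1 (toIcoMod Real.two_pi_pos 0 x) =
        braidCurve n l₁ l₂ 1 x := fun x => by
      rw [toIcoMod, (h.periodic_braidCurve 1).sub_zsmul_eq]
    rw [← hmod (s / n), ← hmod (t / n)] at h1
    have hm : ∀ x, toIcoMod Real.two_pi_pos 0 x ∈ Ico 0 (2 * Real.pi) := fun x => by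
      simpa using toIcoMod_mem_Ico Real.two_pi_pos 0 x
    obtain ⟨k, hk⟩ := (toIcoMod_eq_toIcoMod Real.two_pi_pos).1 (h.simple (hm _) (hm _) h1)
    refine ⟨k, ?_⟩
    rw [zsmul_eq_mul, ← sub_div, div_eq_iff h.cast_pos.ne'] at hk
    linarith

/-- The derivative of the height function. -/
lemma hasDerivAt_height (ε : ℝ) (v : E3) (s : ℝ) :
    HasDerivAt (fun t => inner ℝ v (angleCurve n l₁ l₂ ε t))
      (pertDeriv (braidPert (fun s => l₁ (s / n)) fun s => l₂ (s / n)) ε v 0 s) s := by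
  have d1 : ContDiff ℝ ∞ fun s : ℝ => l₁ (s / n) := h.smooth₁.comp (contDiff_id.div_const _)
  have d2 : ContDiff ℝ ∞ fun s : ℝ => l₂ (s / n) := h.smooth₂.comp (contDiff_id.div_const _)
  have hA := iteratedDeriv_hasDerivAt (d1.mul Real.contDiff_cos) 0 s
  have hB := iteratedDeriv_hasDerivAt (d1.mul Real.contDiff_sin) 0 s
  have hD := iteratedDeriv_hasDerivAt d2 0 s
  simp only [iteratedDeriv_zero] at hA hB hD
  have hmain : HasDerivAt (fun t => v 0 * Real.cos t + v 1 * Real.sin t + v 2 * Real.cos t ^ 2)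
      (etaDeriv v 0 s) s := by
    refine ((((Real.hasDerivAt_cos s).const_mul (v 0)).add
      ((Real.hasDerivAt_sin s).const_mul (v 1))).add
      (((Real.hasDerivAt_cos s).pow 2).const_mul (v 2))).congr_deriv ?_
    simp only [etaDeriv, Real.sin_two_mul]
    norm_num
    ring
  have := hmain.add ((((hA.const_mul (v 0)).add (hB.const_mul (v 1))).add
    (hD.const_mul (v 2))).const_mul ε)
  refine (this.congr_deriv rfl).congr_of_eventuallyEq (Eventually.of_forall fun t => ?_)
  simp only [h.angleCurve_eq, inner_vec, Pi.add_apply]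
  ring

/-- The uniform bounds on critical points for the perturbations of the given type. -/
lemma exists_bounds : ∃ r > 0, r ≤ 1 ∧ ∀ ε, |ε| < r → ∀ v : E3, ‖v‖ = 1 →
    (∀ s, |pertDeriv (braidPert (fun s => l₁ (s / n)) fun s => l₂ (s / n)) ε v 0 s -
      etaDeriv v 0 s| < 1 / 4) ∧
    ∃ a, FewZeros 5 (pertDeriv (braidPert (fun s => l₁ (s / n)) fun s => l₂ (s / n)) ε v 0) a ∧
      (v 0 < 0 → 0 < v 2 → InheritsZeros
        (pertDeriv (braidPert (fun s => l₁ (s / n)) fun s => l₂ (s / n)) ε v 0)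
        (etaDeriv v 0) a) ∧
      (|v 2| < r →
        FewZeros 3 (pertDeriv (braidPert (fun s => l₁ (s / n)) fun s => l₂ (s / n)) ε v 0) a) := by
  have d1 : ContDiff ℝ ∞ fun s : ℝ => l₁ (s / n) := h.smooth₁.comp (contDiff_id.div_const _)
  have d2 : ContDiff ℝ ∞ fun s : ℝ => l₂ (s / n) := h.smooth₂.comp (contDiff_id.div_const _)
  obtain ⟨C, hC0, hC⟩ := exists_bound_braidPert d1 d2 h.pos (h.periodic_div h.periodic₁)
    (h.periodic_div h.periodic₂)
  have hle : ∀ s : ℝ, |s| < 3 * Real.pi / 4 → |s / n| ≤ 3 * Real.pi / (4 * n) := by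
    intro s hs
    rw [abs_div, abs_of_pos h.cast_pos, ← div_div]
    exact div_le_div_of_nonneg_right hs.le h.cast_pos.le
  obtain ⟨r, hr, H⟩ := exists_uniform_zero_bounds (braidPert_hasDerivAt d1 d2) hC
    (braidPert_eq_zero (fun s hs => (h.as_eta _ (hle s hs)).1)
      fun s hs => (h.as_eta _ (hle s hs)).2)
  -- The last entry makes `|ε| * C < 1/4`, the margin for the sign tests in the lower bounds.
  refine ⟨min (min r 1) (1 / (4 * (C + 1))), by positivity,
    (min_le_left _ _).trans (min_le_right _ _), fun ε hε v hv => ⟨fun s => ?_, ?_⟩⟩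
  · have h1 : |ε| < 1 / (4 * (C + 1)) := hε.trans_le (min_le_right _ _)
    rw [lt_div_iff₀ (by positivity)] at h1
    have h2 := hC v hv 0 (by norm_num) s
    rw [pertDeriv, add_sub_cancel_left, abs_mul]
    nlinarith [abs_nonneg ε, mul_le_mul_of_nonneg_left h2 (abs_nonneg ε)]
  · have hmin : min (min r 1) (1 / (4 * (C + 1))) ≤ r := (min_le_left _ _).trans (min_le_left _ _)
    obtain ⟨a, h1, h2, h3⟩ := H ε (hε.trans_le hmin) v hv
    exact ⟨a, h1, h2, fun hv2 => h3 (hv2.trans_le hmin)⟩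

lemma periodic_height_deriv {ε : ℝ} (h0 : 0 < ε) (h1 : ε ≤ 1) (v : E3) :
    Function.Periodic (pertDeriv (braidPert (fun s => l₁ (s / n)) fun s => l₂ (s / n)) ε v 0)
      (n * (2 * Real.pi)) :=
  periodic_of_hasDerivAt (h.hasDerivAt_height ε v) fun t => by
    simp only [(h.isSimpleClosed h0 h1).periodic t]

lemma encard_le_of_fewZeros {ε : ℝ} (h0 : 0 < ε) (h1 : ε ≤ 1) {v : E3} {a : ℝ} {m : ℕ}
    (hf : FewZeros (2 * m + 1)
      (pertDeriv (braidPert (fun s => l₁ (s / n)) fun s => l₂ (s / n)) ε v 0) a) :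
    (localMaxPoints (braidKnot n l₁ l₂ ε) v).encard ≤ (m * n : ℕ) := by
  rw [← h.range_angleCurve]
  exact (h.isSimpleClosed h0 h1).encard_le (h.hasDerivAt_height ε v)
    (h.periodic_height_deriv h0 h1 v) hf

/-- The vertical direction has `2n` local maxima. -/
lemma le_encard_vertical {ε : ℝ} (h0 : 0 < ε) (h1 : ε ≤ 1)
    (hb : ∀ s, |pertDeriv (braidPert (fun s => l₁ (s / n)) fun s => l₂ (s / n)) ε !₂[0, 0, 1] 0 s -
      etaDeriv !₂[0, 0, 1] 0 s| < 1 / 4) :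
    ((2 * n : ℕ) : ℕ∞) ≤ (localMaxPoints (braidKnot n l₁ l₂ ε) !₂[0, 0, 1]).encard := by
  have he : ∀ s, etaDeriv !₂[0, 0, 1] 0 s = -Real.sin (2 * s) := fun s => by simp [etaDeriv]
  -- The unperturbed derivative is `±1` at `jπ ∓ π/4`, well beyond the error `1/4`.
  have hm : ∀ j : ℕ, Real.sin (2 * (0 + j * Real.pi - Real.pi / 4)) = -1 := fun j => by
    rw [show 2 * (0 + j * Real.pi - Real.pi / 4) = -(Real.pi / 2) + j * (2 * Real.pi) by ring,
      Real.sin_add_nat_mul_two_pi, Real.sin_neg, Real.sin_pi_div_two]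
  have hp : ∀ j : ℕ, Real.sin (2 * (0 + j * Real.pi + Real.pi / 4)) = 1 := fun j => by
    rw [show 2 * (0 + j * Real.pi + Real.pi / 4) = Real.pi / 2 + j * (2 * Real.pi) by ring,
      Real.sin_add_nat_mul_two_pi, Real.sin_pi_div_two]
  rw [← h.range_angleCurve]
  refine (h.isSimpleClosed h0 h1).le_encard_of_sign (h.hasDerivAt_height ε _) (N := 2 * n)
    (x₀ := 0) (d := Real.pi) (r := Real.pi / 4) (by positivity) (by linarith [Real.pi_pos])
    (by push_cast; linarith) (fun j => ?_) fun j => ?_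
  · have := hb (0 + j * Real.pi - Real.pi / 4)
    rw [he, hm, abs_lt] at this
    linarith [this.1]
  · have := hb (0 + j * Real.pi + Real.pi / 4)
    rw [he, hp, abs_lt] at this
    linarith [this.2]

/-- A nearly horizontal direction has a local maximum in each turn. -/
lemma le_encard_horizontal {ε : ℝ} (h0 : 0 < ε) (h1 : ε ≤ 1) {v : E3} (hv : ‖v‖ = 1)
    (hv2 : |v 2| < 1 / 2)
    (hb : ∀ s, |pertDeriv (braidPert (fun s => l₁ (s / n)) fun s => l₂ (s / n)) ε v 0 s -
      etaDeriv v 0 s| < 1 / 4) :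
    (n : ℕ∞) ≤ (localMaxPoints (braidKnot n l₁ l₂ ε) v).encard := by
  obtain ⟨x₀, ρ, hρ0, e0, e1⟩ : ∃ x₀ ρ : ℝ, 0 ≤ ρ ∧ v 0 = ρ * Real.cos x₀ ∧
      v 1 = ρ * Real.sin x₀ := by
    let w : ℂ := ⟨v 0, v 1⟩
    refine ⟨w.arg, ‖w‖, norm_nonneg _, ?_, ?_⟩
    · rw [Complex.norm_mul_cos_arg]
    · rw [Complex.norm_mul_sin_arg]
  have hn := norm_sq_E3 v
  have hsc := Real.sin_sq_add_cos_sq x₀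
  -- At the test points the sinusoid has size `ρ > 3/4`, which beats the `v 2` term `1/2` plus the
  -- perturbation `1/4`.
  have hρ : 3 / 4 < ρ := by
    have h2 : v 2 ^ 2 < 1 / 4 := by
      rw [← sq_abs]; nlinarith [abs_nonneg (v 2)]
    have : ρ ^ 2 = 1 - v 2 ^ 2 := by
      rw [hv, e0, e1] at hn
      linear_combination -hn - ρ ^ 2 * hsc
    nlinarith
  have hs2 : ∀ s, |v 2 * Real.sin (2 * s)| < 1 / 2 := fun s => by
    rw [abs_mul]
    exact (mul_le_of_le_one_right (abs_nonneg _) (Real.abs_sin_le_one _)).trans_lt hv2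
  have heq : ∀ s, etaDeriv v 0 s = -ρ * Real.sin (s - x₀) - v 2 * Real.sin (2 * s) := fun s => by
    simp only [etaDeriv, e0, e1, Real.sin_sub]; ring
  rw [← h.range_angleCurve]
  refine (h.isSimpleClosed h0 h1).le_encard_of_sign (h.hasDerivAt_height ε _) (N := n)
    (x₀ := x₀) (d := 2 * Real.pi) (r := Real.pi / 2) (by positivity) (by linarith [Real.pi_pos])
    le_rfl (fun j => ?_) fun j => ?_
  · have a := hb (x₀ + j * (2 * Real.pi) - Real.pi / 2)
    have b := hs2 (x₀ + j * (2 * Real.pi) - Real.pi / 2)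
    rw [heq, show x₀ + j * (2 * Real.pi) - Real.pi / 2 - x₀ = -(Real.pi / 2) + j * (2 * Real.pi) by
      ring, Real.sin_add_nat_mul_two_pi, Real.sin_neg, Real.sin_pi_div_two] at a
    rw [abs_lt] at a b
    linarith [a.1, b.2]
  · have a := hb (x₀ + j * (2 * Real.pi) + Real.pi / 2)
    have b := hs2 (x₀ + j * (2 * Real.pi) + Real.pi / 2)
    rw [heq, show x₀ + j * (2 * Real.pi) + Real.pi / 2 - x₀ = Real.pi / 2 + j * (2 * Real.pi) by
      ring, Real.sin_add_nat_mul_two_pi, Real.sin_pi_div_two] at a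
    rw [abs_lt] at a b
    linarith [a.2, b.1]

end IsBraidData

/-! ### The curve `η` as a one-strand braid -/

/-- The unperturbed curve as a braid with one strand. -/
lemma isBraidData_zero : IsBraidData 1 (fun _ => 0) fun _ => 0 where
  pos := one_pos
  smooth₁ := contDiff_const
  smooth₂ := contDiff_const
  periodic₁ := fun _ => rfl
  periodic₂ := fun _ => rfl
  simple := by
    intro s hs t ht he
    have ex := congrArg (fun q : E3 => q 0) he
    have ey := congrArg (fun q : E3 => q 1) he
    simp [braidCurve] at ex ey
    by_contra hne
    refine cos_sub_ne_one hne ?_ ?_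
    · rw [abs_lt]; constructor <;> linarith [hs.1, hs.2, ht.1, ht.2]
    · rw [Real.cos_sub, ex, ey]; linarith [Real.sin_sq_add_cos_sq t]
  in_torus := fun _ => by norm_num
  as_eta := fun _ _ => ⟨rfl, rfl⟩
  locallyConstant₁ := IsLocallyConstant.const 0
  locallyConstant₂ := IsLocallyConstant.const 0
  neg := by
    rintro t ⟨h1, h2, -⟩
    exfalso
    norm_num at h1
    linarith [Real.pi_pos]

lemma eta_eq_braidKnot (ε : ℝ) : eta = braidKnot 1 (fun _ => 0) (fun _ => 0) ε := by
  ext q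
  constructor
  · rintro ⟨x, y, hxy, rfl⟩
    let w : ℂ := ⟨x, y⟩
    have hw : ‖w‖ = 1 := by
      rw [← sq_eq_sq₀ (norm_nonneg _) zero_le_one, Complex.sq_norm, Complex.normSq_mk]
      linarith
    have hc := Complex.norm_mul_cos_arg w
    have hs := Complex.norm_mul_sin_arg w
    rw [hw, one_mul] at hc hs
    refine ⟨w.arg, ?_⟩
    simp [braidCurve, hc, hs, w]
  · rintro ⟨t, rfl⟩
    refine ⟨Real.cos t, Real.sin t, Real.cos_sq_add_sin_sq t, ?_⟩
    simp [braidCurve]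

lemma encard_eta_le {v : E3} (hv : ‖v‖ = 1) : (localMaxPoints eta v).encard ≤ 2 := by
  obtain ⟨r, hr, hr1, H⟩ := isBraidData_zero.exists_bounds
  obtain ⟨-, a, ha, -⟩ := H (r / 2) (by rw [abs_of_pos (by positivity)]; linarith) v hv
  rw [eta_eq_braidKnot (r / 2)]
  have := isBraidData_zero.encard_le_of_fewZeros (m := 2) (by positivity) (by linarith) ha
  exact_mod_cast this

/-- One of two consecutive critical points is a local maximum. -/
lemma exists_neg_of_consecutive {v : E3} (hv : ‖v‖ = 1) {a : ℝ} {u : Fin 4 → ℝ}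
    (hu : StrictMono u) (hm : ∀ l, u l ∈ Ioo (a - 2 * Real.pi) a)
    (h0 : ∀ l, etaDeriv v 0 (u l) = 0) {i j : Fin 4} (hij : i < j) (hcons : ∀ l, l ≤ i ∨ j ≤ l) :
    etaDeriv v 1 (u i) < 0 ∨ etaDeriv v 1 (u j) < 0 := by
  have hs := simple_of_four_zeros hv hu.injective (fun k l => abs_sub_lt_of_mem_Ioo (hm k) (hm l)) h0
  by_contra! hcon
  have hi := lt_of_le_of_ne hcon.1 (hs i).symm
  have hj := lt_of_le_of_ne hcon.2 (hs j).symm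
  have d := etaDeriv_hasDerivAt v (j := 0) (by norm_num)
  -- If both slopes were positive, the function would be positive just after `u i` and negative just
  -- before `u j`, producing a fifth zero.
  obtain ⟨x, hx, hxI⟩ := ((eventually_sign_of_hasDerivAt_pos (d (u i)) hi).1.and
    (Ioo_mem_nhdsGT (hu hij))).exists
  obtain ⟨y, hy, hyI⟩ := ((eventually_sign_of_hasDerivAt_pos (d (u j)) hj).2.and
    (Ioo_mem_nhdsLT hxI.2)).exists
  rw [h0] at hx hy
  obtain ⟨w, hw, hw0⟩ := intermediate_value_Icc' hyI.1.le (etaDeriv_continuous v 0).continuousOn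
    (show (0 : ℝ) ∈ Icc (etaDeriv v 0 y) (etaDeriv v 0 x) from ⟨hy.le, hx.le⟩)
  have hw1 : u i < w := hxI.1.trans_le hw.1
  have hw2 : w < u j := hw.2.trans_lt hyI.2
  have hwm : w ∈ Ioo (a - 2 * Real.pi) a := ⟨(hm i).1.trans hw1, hw2.trans (hm j).2⟩
  have hall : ∀ k, (Fin.cons w u : Fin 5 → ℝ) k ∈ Ioo (a - 2 * Real.pi) a :=
    Fin.cases hwm hm
  refine etaDeriv_zeros_le_four hv (z := Fin.cons w u) ?_
    (fun k l => abs_sub_lt_of_mem_Ioo (hall k) (hall l)) (Fin.cases hw0 h0)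
  rw [Fin.cons_injective_iff]
  refine ⟨?_, hu.injective⟩
  rintro ⟨l, rfl⟩
  rcases hcons l with h | h
  · exact absurd (hu.monotone h) (not_le.2 hw1)
  · exact absurd (hu.monotone h) (not_le.2 hw2)

/-- Four distinct critical points are nondegenerate, and each of the pairs `(u 0, u 1)` and `(u 2, u
3)` contains a maximum. -/
lemma two_le_encard_eta {v : E3} (hv : ‖v‖ = 1) {a : ℝ} {u : Fin 4 → ℝ}
    (hu : Function.Injective u) (hm : ∀ l, u l ∈ Ioo (a - 2 * Real.pi) a)
    (h0 : ∀ l, etaDeriv v 0 (u l) = 0) : 2 ≤ (localMaxPoints eta v).encard := by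
  classical
  wlog hmono : StrictMono u generalizing u
  · have hc : (Finset.univ.image u).card = 4 := by
      rw [Finset.card_image_of_injective _ hu]; simp
    have hmem : ∀ l, ∃ k, u k = (Finset.univ.image u).orderEmbOfFin hc l := fun l => by
      obtain ⟨k, -, hk⟩ := Finset.mem_image.1 ((Finset.univ.image u).orderEmbOfFin_mem hc l)
      exact ⟨k, hk⟩
    have hsm := ((Finset.univ.image u).orderEmbOfFin hc).strictMono
    refine this hsm.injective (fun l => ?_) (fun l => ?_) hsm
    · obtain ⟨k, hk⟩ := hmem l; rw [← hk]; exact hm k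
    · obtain ⟨k, hk⟩ := hmem l; rw [← hk]; exact h0 k
  have hd : ∀ s, HasDerivAt (fun t => inner ℝ v (angleCurve 1 (fun _ => 0) (fun _ => 0) 1 t))
      (etaDeriv v 0 s) s := fun s => by
    have hs := isBraidData_zero.hasDerivAt_height 1 v s
    have hz : braidPert (fun _ => 0) (fun _ => 0) v 0 s = 0 :=
      braidPert_eq_zero (r := |s| + 1) (fun _ _ => rfl) (fun _ _ => rfl) v s (by linarith)
    rwa [pertDeriv, hz, mul_zero, add_zero] at hs
  have hloc : ∀ l, etaDeriv v 1 (u l) < 0 →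
      IsLocalMax (fun t => inner ℝ v (angleCurve 1 (fun _ => 0) (fun _ => 0) 1 t)) (u l) := by
    intro l hl
    have e : deriv (fun t => inner ℝ v (angleCurve 1 (fun _ => 0) (fun _ => 0) 1 t)) =
        etaDeriv v 0 := funext fun s => (hd s).deriv
    refine isLocalMax_of_deriv_deriv_neg ?_ ?_ (hd _).continuousAt
    · rw [e, (etaDeriv_hasDerivAt v (by norm_num) _).deriv]; exact hl
    · rw [e]; exact h0 l
  obtain ⟨i, hi, hi1⟩ : ∃ i : Fin 4, etaDeriv v 1 (u i) < 0 ∧ i ≤ 1 := by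
    rcases exists_neg_of_consecutive hv hmono hm h0 (i := 0) (j := 1) (by decide) (by decide)
      with h | h
    · exact ⟨0, h, by decide⟩
    · exact ⟨1, h, by decide⟩
  obtain ⟨j, hj, hj1⟩ : ∃ j : Fin 4, etaDeriv v 1 (u j) < 0 ∧ 2 ≤ j := by
    rcases exists_neg_of_consecutive hv hmono hm h0 (i := 2) (j := 3) (by decide) (by decide)
      with h | h
    · exact ⟨2, h, by decide⟩
    · exact ⟨3, h, by decide⟩
  have hij : u i < u j := hmono (lt_of_le_of_lt hi1 (lt_of_lt_of_le (by decide) hj1))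
  rw [eta_eq_braidKnot 1, ← isBraidData_zero.range_angleCurve]
  have hmem : ∀ l, u l ∈ Ico (a - 2 * Real.pi) (a - 2 * Real.pi + (1 : ℕ) * (2 * Real.pi)) :=
    fun l => ⟨(hm l).1.le, by push_cast; linarith [(hm l).2]⟩
  have := (isBraidData_zero.isSimpleClosed one_pos le_rfl).le_encard_localMaxPoints v (N := 2)
    (p := ![u i, u j]) (by
      intro k l hkl
      fin_cases k <;> fin_cases l <;> simp_all [hij.ne, hij.ne'])
    (Fin.forall_fin_two.2 ⟨hmem i, hmem j⟩) (Fin.forall_fin_two.2 ⟨hloc i hi, hloc j hj⟩)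
  exact_mod_cast this

end Superbridge

/-! ### Conclusion -/

open Superbridge in
theorem mainTheorem6 (n : ℕ) (l₁ l₂ : ℝ → ℝ) (h : Superbridge.IsBraidData n l₁ l₂) :
    ∃ ε₀ δ₀ : ℝ, 0 < ε₀ ∧ ε₀ ≤ 1 ∧ 0 < δ₀ ∧
      ∀ ε : ℝ, 0 < ε → ε ≤ ε₀ →
        Superbridge.superbridgeNumber (Superbridge.braidKnot n l₁ l₂ ε) = 2 * (n : ℕ∞) ∧
        Superbridge.upperDirections (Superbridge.braidKnot n l₁ l₂ ε) (2 * (n : ℕ∞))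
            ∩ {v | v 0 < 0} ⊆ Superbridge.dirN ∩ {v | v 0 < 0} ∧
        ∀ v : Superbridge.E3, ‖v‖ = 1 → |v 2| < δ₀ →
          Superbridge.crookedness v (Superbridge.braidKnot n l₁ l₂ ε) = (n : ℕ∞) := by
  obtain ⟨r, hr, hr1, H⟩ := h.exists_bounds
  -- In `δ₀`, the entry `r` serves the upper bound in (c) and `1 / 2` the lower bound.
  refine ⟨r / 2, min r (1 / 2), by positivity, by linarith, by positivity, fun ε h0 hε => ?_⟩
  have h1 : ε ≤ 1 := by linarith
  have H := H ε (by rw [abs_of_pos h0]; linarith)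
  have hle : ∀ v : E3, ‖v‖ = 1 →
      (localMaxPoints (braidKnot n l₁ l₂ ε) v).encard ≤ ((2 * n : ℕ) : ℕ∞) := fun v hv => by
    obtain ⟨-, a, ha, -⟩ := H v hv
    exact h.encard_le_of_fewZeros (m := 2) h0 h1 ha
  have heq : ∀ v : E3, ‖v‖ = 1 → crookedness v (braidKnot n l₁ l₂ ε) =
      (localMaxPoints (braidKnot n l₁ l₂ ε) v).encard := fun v hv =>
    crookedness_eq_encard (Set.finite_of_encard_le_coe (hle v hv))
  refine ⟨le_antisymm (iSup_le fun v => ?_) ?_, ?_, fun v hv hv2 => ?_⟩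
  · have hv : ‖(v : E3)‖ = 1 := mem_sphere_zero_iff_norm.1 v.2
    rw [heq _ hv]
    exact_mod_cast hle _ hv
  · have hv : ‖(!₂[0, 0, 1] : E3)‖ = 1 := by simp [EuclideanSpace.norm_eq, Fin.sum_univ_three]
    refine le_trans ?_ (le_iSup (fun v : Metric.sphere (0 : E3) 1 =>
      crookedness (v : E3) (braidKnot n l₁ l₂ ε)) ⟨_, mem_sphere_zero_iff_norm.2 hv⟩)
    simp only [heq _ hv]
    exact_mod_cast h.le_encard_vertical h0 h1 (H _ hv).1
  · rintro v ⟨⟨hvs, hv2, hc⟩, hv0⟩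
    have hv : ‖v‖ = 1 := mem_sphere_zero_iff_norm.1 hvs
    refine ⟨⟨hvs, hv2, ?_⟩, hv0⟩
    obtain ⟨-, a, ha, hinh, -⟩ := H v hv
    have hge : ((2 * n : ℕ) : ℕ∞) ≤
        (localMaxPoints (Set.range (angleCurve n l₁ l₂ ε)) v).encard := by
      rw [h.range_angleCurve, ← heq v hv, hc]
      push_cast
      exact le_rfl
    obtain ⟨z, hz, hzm, hz0⟩ := (h.isSimpleClosed h0 h1).exists_four_zeros_of_le h.pos
      (h.hasDerivAt_height ε v) (h.periodic_height_deriv h0 h1 v) ha hge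
    obtain ⟨u, hu, hum, hu0⟩ := hinh hv0 hv2 z hz hzm hz0
    have hup := encard_eta_le hv
    rw [crookedness_eq_encard (Set.finite_of_encard_le_coe (k := 2) (by exact_mod_cast hup))]
    exact le_antisymm hup (two_le_encard_eta hv hu hum hu0)
  · obtain ⟨hb, a, -, -, h3⟩ := H v hv
    rw [heq v hv]
    refine le_antisymm ?_ (h.le_encard_horizontal h0 h1 hv (hv2.trans_le (min_le_right _ _)) hb)
    have := h.encard_le_of_fewZeros (m := 1) h0 h1 (h3 (hv2.trans_le (min_le_left _ _)))
    rwa [one_mul] at this
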